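/- **Setting.** Let $S=[-\tfrac12,\tfrac12]^2$ be the unit square and let $f$ be a (measurable) density on $S$ with $\int_S f=1$ and $\epsilon_1\le f\le\epsilon_2$ on $S$, where $0<\epsilon_1\le\epsilon_2<\infty$. For each $n\ge1$ let $r_n>0$ and $s_n\ge0$ be real numbers such that $K_n:=\frac{1-r_n}{r_n+s_n}$ is a non-negative integer, and tile $S$ regularly by the $(K_n+1)^2$ closed squares of side $r_n$ whose lower left corners are $(-\tfrac12+i(r_n+s_n),\,-\tfrac12+j(r_n+s_n))$, $0\le i,j\le K_n$; neighbouring squares are at distance $s_n$. Index each square by $(i,j)\in\mathbb Z^2$. Choose $N=N(n)\ge1$ of these squares, $S_1,\dots,S_N$ (the cities), which are well-connected: their indices induce a connected subgraph of the nearest-neighbour graph on $\mathbb Z^2$. Let $X_1,\dots,X_n$ be i.i.d. with density $g_N(x)=f(x)\big/\int_{\bigcup_j S_j}f$ on $\bigcup_{j\le N}S_j$ (and $0$ elsewhere), let $TSPC_n$ be the minimum Euclidean length of a cycle through all of $X_1,\dots,X_n$, and let $b_n=r_n\sqrt{nN}$. **Theorem.** There are positive constants $M_0,\theta_1,\dots,\theta_6$,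 depending only on $\epsilon_1,\epsilon_2$, such that the following holds for every $M\ge M_0$. Suppose that $r_n^2\ge \frac{M\log n}{n}$ for all large $n$, and that $\frac{n}{N^2}\to0$ and $\frac{N s_n}{b_n}\to0$ as $n\to\infty$. Then $TSPC_n$ is integrable for every $n$, $$\frac{1}{b_n}\left(TSPC_n-\mathbb E\,TSPC_n\right)\to0\quad\text{in probability as } n\to\infty,$$ and for all large $n$ $$\theta_1b_n\le\mathbb E\,TSPC_n\le\theta_2b_n,$$ $$\mathbb P\left(TSPC_n\ge\theta_3b_n\right)\ge1-e^{-\theta_4N},\qquad \mathbb P\left(TSPC_n\le\theta_5b_n\right)\ge1-\exp\left(-\theta_6\frac nN\right).$$ -/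

import Mathlib

open MeasureTheory ProbabilityTheory Filter Topology

/-- The Euclidean plane. -/
abbrev Plane : Type := EuclideanSpace ℝ (Fin 2)

/-- The (closed) unit square, centred at the origin. -/
def unitSquare : Set Plane :=
  {x | ∀ k : Fin 2, x k ∈ Set.Icc (-(1 / 2) : ℝ) (1 / 2)}

/-- The nearest-neighbour graph on the lattice of integer points:
`z` and `w` are adjacent when their `ℓ¹`-distance is `1`. -/
def latticeGraph : SimpleGraph (ℤ × ℤ) where
  Adj z w := |z.1 - w.1| + |z.2 - w.2| = 1
  symm := ⟨fun z w h => by rw [abs_sub_comm w.1, abs_sub_comm w.2]; exact h⟩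
  loopless := ⟨fun z h => by simp at h⟩

/-- A family of well-connected cities in the unit square: the unit square is tiled by
`(K + 1)²` squares of side `r` at mutual distance at least `s`, the integer `K` being
`(1 - r) / (r + s)`; the squares are indexed by the lattice points of `{0, …, K}²`, and the
chosen cities are those indexed by a finite set whose induced lattice subgraph is connected
(in particular non-empty). -/
structure CityConfig where
  /-- side length of a city -/
  r : ℝ
  /-- intercity distance -/
  s : ℝ
  /-- number of gaps in each row of the tiling -/
  K : ℕ
  /-- indices of the chosen cities -/
  cities : Finset (ℤ × ℤ)
  r_pos : 0 < r
  s_nonneg : 0 ≤ s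
  grid : (1 - r) / (r + s) = (K : ℝ)
  mem_grid : ∀ z ∈ cities, z.1 ∈ Set.Icc (0 : ℤ) K ∧ z.2 ∈ Set.Icc (0 : ℤ) K
  connected : (latticeGraph.induce (cities : Set (ℤ × ℤ))).Connected

namespace CityConfig

/-- The number `N` of cities. -/
def N (C : CityConfig) : ℕ := C.cities.card

/-- The `r × r` square of the tiling with lattice index `z`. -/
def square (C : CityConfig) (z : ℤ × ℤ) : Set Plane :=
  {x | x 0 ∈ Set.Icc (-(1 / 2) + z.1 * (C.r + C.s)) (-(1 / 2) + z.1 * (C.r + C.s) + C.r) ∧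
       x 1 ∈ Set.Icc (-(1 / 2) + z.2 * (C.r + C.s)) (-(1 / 2) + z.2 * (C.r + C.s) + C.r)}

/-- The union of the chosen cities. -/
def region (C : CityConfig) : Set Plane := ⋃ z ∈ C.cities, C.square z

/-- The density `g_N`: `f` restricted to the union of the cities and normalised. -/
noncomputable def density (C : CityConfig) (f : Plane → ℝ) : Plane → ℝ :=
  C.region.indicator fun x => f x / ∫ y in C.region, f y

/-- The scaling `b_n = r_n √(n N)`. -/
noncomputable def scale (C : CityConfig) (n : ℕ) : ℝ := C.r * Real.sqrt ((n : ℝ) * C.N)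

end CityConfig

/-- The length of the closed tour that visits the nodes `x` in the cyclic order
`x (σ 0), x (σ 1), …, x (σ (n - 1)), x (σ 0)`. -/
noncomputable def tourLength {n : ℕ} (x : Fin n → Plane) (σ : Equiv.Perm (Fin n)) : ℝ :=
  ∑ i : Fin n, dist (x (σ i)) (x (σ (finRotate n i)))

/-- The minimum length of a cycle through all the nodes `x` (a minimum over a finite
non-empty set of cycles). -/
noncomputable def tspLength {n : ℕ} (x : Fin n → Plane) : ℝ :=
  ⨅ σ : Equiv.Perm (Fin n), tourLength x σ

/-! Write `T` for the shortest tour and `b = r √(nN)`. For large `n`, almost surely `T ≤ 32 b`; also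
`T ≥ θ b` off an event of probability `e⁻ⁿ`, and `Var T ≤ 32 n r² = 32 b² / N`.

Upper bound (`CityConfig.tspLength_le`, deterministic): connectedness gives a tour of the city
corners of length at most `4N(r + s)`. By pigeonhole, among `k` points of the region and the
corners, some point has a neighbour within `6 r √(N/k)`. Inserting points one by one at twice that
cost sums to at most `24 b`; the corners are then skipped. As `N ≤ n` and `N s ≤ b` eventually, the
total is at most `32 b`.

Lower bound (`measure_tspLength_lt_le`): for a fixed ordering the exponential moment of minus the
path length is controlled one step at a time, because the node law has density of order `1/(N r²)`.
A Chernoff bound beats the `n!` orderings.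

Concentration (`efronStein`, `CityConfig.variance_tspLength_le_mul`): deleting a node changes `T` by
at most `4r` unless some city contains no other node, which `r² ≥ M log n / n` makes rare. Chebyshev
finishes, since `n/N² → 0` forces `N → ∞`. -/

section Tours

/-! ### Tours as lists of points: insertion and deletion. -/

variable {E : Type*} [PseudoMetricSpace E]

/-- Length of the polygonal path from `a` to `c` through the points of a list. -/
noncomputable def pathLength : E → List E → E → ℝ
  | a, [], c => dist a c
  | a, b :: l, c => dist a b + pathLength b l c

/-- Length of the closed tour visiting the points of a list in cyclic order. -/
noncomputable def cycleLength : List E → ℝ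
  | [] => 0
  | a :: l => pathLength a l a

theorem pathLength_append (a b c : E) (l₁ l₂ : List E) :
    pathLength a (l₁ ++ b :: l₂) c = pathLength a l₁ b + pathLength b l₂ c := by
  induction l₁ generalizing a with
  | nil => simp [pathLength]
  | cons d l ih => simp only [List.cons_append, pathLength, ih]; ring

theorem pathLength_le_dist_add_left (a b c : E) (l : List E) :
    pathLength a l c ≤ dist a b + pathLength b l c := by
  cases l with
  | nil => exact dist_triangle a b c
  | cons d l => simp only [pathLength]; linarith [dist_triangle a b d]

theorem pathLength_le_add_dist_right (a b c : E) (l : List E) :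
    pathLength a l c ≤ pathLength a l b + dist b c := by
  induction l generalizing a with
  | nil => exact dist_triangle a b c
  | cons d l ih => simp only [pathLength]; linarith [ih d]

theorem cycleLength_append_comm (l₁ l₂ : List E) :
    cycleLength (l₁ ++ l₂) = cycleLength (l₂ ++ l₁) := by
  cases l₁ with
  | nil => simp
  | cons a l₁ =>
    cases l₂ with
    | nil => simp
    | cons b l₂ =>
      simp only [List.cons_append, cycleLength, pathLength_append]; ring

/-- Some closed tour through the multiset `m` of points has length at most `B`. -/
def HasTour (m : Multiset E) (B : ℝ) : Prop :=
  ∃ l : List E, (l : Multiset E) = m ∧ cycleLength l ≤ B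

theorem HasTour.mono {m : Multiset E} {B B' : ℝ} (h : HasTour m B) (hB : B ≤ B') :
    HasTour m B' :=
  let ⟨l, hl, hlB⟩ := h; ⟨l, hl, hlB.trans hB⟩

theorem HasTour.exists_cons {m : Multiset E} {B : ℝ} (h : HasTour m B) {a : E} (ha : a ∈ m) :
    ∃ l : List E, ((a :: l : List E) : Multiset E) = m ∧ pathLength a l a ≤ B := by
  obtain ⟨l, rfl, hlB⟩ := h
  obtain ⟨l₁, l₂, rfl⟩ := List.append_of_mem (Multiset.mem_coe.1 ha)
  refine ⟨l₂ ++ l₁, ?_, ?_⟩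
  · rw [Multiset.coe_eq_coe]
    exact List.perm_append_comm (l₁ := a :: l₂)
  · rw [cycleLength_append_comm] at hlB
    exact hlB

/-- The tour makes a detour from `b` to `a` and back. -/
theorem HasTour.insert {m : Multiset E} {B : ℝ} (h : HasTour m B) {a b : E} (hb : b ∈ m) :
    HasTour (a ::ₘ m) (B + 2 * dist a b) := by
  obtain ⟨l, rfl, hl⟩ := h.exists_cons hb
  refine ⟨b :: a :: l, ?_, ?_⟩
  · rw [← Multiset.cons_coe, ← Multiset.cons_coe, ← Multiset.cons_coe, Multiset.cons_swap]
  · have := pathLength_le_dist_add_left a b b l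
    simp only [cycleLength, pathLength, dist_comm b a]
    linarith

theorem HasTour.of_cons {m : Multiset E} {B : ℝ} {a : E} (h : HasTour (a ::ₘ m) B) :
    HasTour m B := by
  obtain ⟨l, hl, hlB⟩ := h.exists_cons (Multiset.mem_cons_self a m)
  rw [← Multiset.cons_coe, Multiset.cons_inj_right] at hl
  refine ⟨l, hl, ?_⟩
  cases l with
  | nil => simpa [cycleLength, pathLength] using hlB
  | cons b l =>
    have := pathLength_le_add_dist_right b a b l
    simp only [cycleLength, pathLength] at hlB ⊢
    linarith

theorem HasTour.of_add {m k : Multiset E} {B : ℝ} (h : HasTour (m + k) B) : HasTour k B := by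
  induction m using Multiset.induction_on with
  | empty => simpa using h
  | cons a m ih => exact ih (by rw [Multiset.cons_add] at h; exact h.of_cons)

theorem hasTour_singleton (a : E) : HasTour ({a} : Multiset E) 0 :=
  ⟨[a], rfl, by simp [cycleLength, pathLength]⟩

theorem pathLength_ofFn {n : ℕ} (a c : E) (y : Fin (n + 1) → E) :
    pathLength a (List.ofFn y) c =
      dist a (y 0) + ∑ i : Fin n, dist (y i.castSucc) (y i.succ) + dist (y (Fin.last n)) c := by
  induction n generalizing a with
  | zero => simp [pathLength]
  | succ n ih =>
    rw [List.ofFn_succ, pathLength, ih, Fin.sum_univ_succ]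
    simp only [Fin.succ_last, Fin.castSucc_zero, Fin.succ_castSucc, Fin.succ_zero_eq_one]
    ring

theorem cycleLength_ofFn {n : ℕ} (y : Fin n → E) :
    cycleLength (List.ofFn y) = ∑ i : Fin n, dist (y i) (y (finRotate n i)) := by
  cases n with
  | zero => simp [cycleLength]
  | succ n =>
    have hrot : ∀ i : Fin n, finRotate (n + 1) i.castSucc = i.succ := fun i => by
      rw [finRotate_apply, Fin.coeSucc_eq_succ]
    rw [List.ofFn_succ, cycleLength, Fin.sum_univ_castSucc, finRotate_last]
    simp only [hrot]
    cases n with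
    | zero => simp [pathLength]
    | succ n =>
      rw [pathLength_ofFn, Fin.sum_univ_succ]
      rfl

/-- Points may coincide, so a reordering of the points does not determine one of the indices; this
lifts it. -/
theorem exists_perm_map_eq {α β : Type*} (x : α → β) {l₁ l₂ : List β} (h : l₁.Perm l₂) :
    ∀ l : List α, l.map x = l₁ → ∃ l' : List α, l'.Perm l ∧ l'.map x = l₂ := by
  induction h with
  | nil => exact fun l hl => ⟨l, .refl l, hl⟩
  | cons a _ ih =>
    intro l hl
    obtain ⟨b, t, rfl, rfl, ht⟩ := List.map_eq_cons_iff.1 hl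
    obtain ⟨t', ht', h'⟩ := ih t ht
    exact ⟨b :: t', ht'.cons b, by simp [h']⟩
  | swap a b t =>
    intro l hl
    obtain ⟨c, t, rfl, rfl, ht⟩ := List.map_eq_cons_iff.1 hl
    obtain ⟨d, t, rfl, rfl, rfl⟩ := List.map_eq_cons_iff.1 ht
    exact ⟨d :: c :: t, .swap _ _ _, by simp⟩
  | trans _ _ ih₁ ih₂ =>
    intro l hl
    obtain ⟨l', h', hl'⟩ := ih₁ l hl
    obtain ⟨l'', h'', hl''⟩ := ih₂ l' hl'
    exact ⟨l'', h''.trans h', hl''⟩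

end Tours

/-! ### The shortest tour under insertion and deletion of a node. -/

theorem tspLength_le_tourLength {n : ℕ} (x : Fin n → Plane) (σ : Equiv.Perm (Fin n)) :
    tspLength x ≤ tourLength x σ :=
  ciInf_le (Set.finite_range _).bddBelow σ

theorem tourLength_nonneg {n : ℕ} (x : Fin n → Plane) (σ : Equiv.Perm (Fin n)) :
    0 ≤ tourLength x σ :=
  Finset.sum_nonneg fun _ _ => dist_nonneg

theorem tspLength_nonneg {n : ℕ} (x : Fin n → Plane) : 0 ≤ tspLength x :=
  le_ciInf fun σ => tourLength_nonneg x σ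

theorem exists_tourLength_eq {n : ℕ} (x : Fin n → Plane) : ∃ σ, tourLength x σ = tspLength x :=
  exists_eq_ciInf_of_finite

/-- Trades permutations of `Fin n` for multisets, where adding or removing a point is immediate. -/
theorem tspLength_le_iff_hasTour {n : ℕ} (x : Fin n → Plane) (B : ℝ) :
    tspLength x ≤ B ↔ HasTour (Finset.univ.val.map x) B := by
  constructor
  · intro h
    obtain ⟨σ, hσ⟩ := exists_tourLength_eq x
    refine ⟨List.ofFn (x ∘ σ), ?_, ?_⟩
    · rw [Fin.univ_val_map, Multiset.coe_eq_coe]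
      exact Equiv.Perm.ofFn_comp_perm σ x
    · rw [cycleLength_ofFn]
      exact hσ.le.trans h
  · rintro ⟨l, hl, hlB⟩
    rw [Fin.univ_val_map, Multiset.coe_eq_coe] at hl
    obtain ⟨t, ht, rfl⟩ := exists_perm_map_eq x hl.symm (List.finRange n)
      (by rw [List.ofFn_eq_map])
    have hlen : t.length = n := by simpa using ht.length_eq
    have hnd : t.Nodup := ht.nodup_iff.2 (List.nodup_finRange n)
    let g : Fin n → Fin n := fun i => t.get (i.cast hlen.symm)
    have hg : Function.Injective g := fun i j hij => by
      simpa using (List.nodup_iff_injective_get.1 hnd) hij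
    have hof : t.map x = List.ofFn (x ∘ Equiv.ofBijective g (Finite.injective_iff_bijective.1 hg)) := by
      apply List.ext_get
      · simp [hlen]
      · intro k h₁ h₂
        simp [g]
    rw [hof, cycleLength_ofFn] at hlB
    exact (tspLength_le_tourLength x _).trans hlB

theorem univ_val_map_succAbove {α : Type*} {n : ℕ} (x : Fin (n + 1) → α) (i : Fin (n + 1)) :
    (Finset.univ.val.map x : Multiset α) =
      x i ::ₘ Finset.univ.val.map (fun j => x (i.succAbove j)) := by
  rw [Fin.univ_succAbove n i]
  simp [Function.comp_def]

theorem tspLength_succAbove_le {n : ℕ} (x : Fin (n + 1) → Plane) (i : Fin (n + 1)) :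
    tspLength (fun j => x (i.succAbove j)) ≤ tspLength x := by
  have h := (tspLength_le_iff_hasTour x _).1 le_rfl
  rw [univ_val_map_succAbove x i] at h
  exact (tspLength_le_iff_hasTour _ _).2 h.of_cons

theorem tspLength_le_succAbove_add {n : ℕ} (x : Fin (n + 1) → Plane) {i j : Fin (n + 1)}
    (hij : j ≠ i) :
    tspLength x ≤ tspLength (fun k => x (i.succAbove k)) + 2 * dist (x i) (x j) := by
  have h := (tspLength_le_iff_hasTour (fun k => x (i.succAbove k)) _).1 le_rfl
  obtain ⟨k, rfl⟩ := Fin.exists_succAbove_eq hij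
  rw [tspLength_le_iff_hasTour, univ_val_map_succAbove x i]
  exact h.insert (Multiset.mem_map_of_mem (fun k => x (i.succAbove k)) (Finset.mem_univ k))

theorem measurable_tourLength {n : ℕ} (σ : Equiv.Perm (Fin n)) :
    Measurable fun x : Fin n → Plane => tourLength x σ := by
  unfold tourLength
  fun_prop

theorem measurable_tspLength (n : ℕ) : Measurable fun x : Fin n → Plane => tspLength x :=
  Measurable.iInf fun σ => measurable_tourLength σ

theorem Plane.dist_le_two_mul {a b : Plane} {δ : ℝ} (hδ : 0 ≤ δ)
    (h : ∀ k, |a k - b k| ≤ δ) : dist a b ≤ 2 * δ := by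
  rw [EuclideanSpace.dist_eq, Real.sqrt_le_left (by positivity), Fin.sum_univ_two,
    Real.dist_eq, Real.dist_eq]
  have h0 := h 0
  have h1 := h 1
  nlinarith [abs_nonneg (a 0 - b 0), abs_nonneg (a 1 - b 1)]

theorem dist_le_of_mem_unitSquare {a b : Plane} (ha : a ∈ unitSquare) (hb : b ∈ unitSquare) :
    dist a b ≤ 2 := by
  refine (Plane.dist_le_two_mul zero_le_one fun k => ?_).trans_eq (mul_one 2)
  have h1 := ha k
  have h2 := hb k
  rw [Set.mem_Icc] at h1 h2
  rw [abs_le]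
  constructor <;> linarith

/-! ### Geometry of the cities and the deterministic upper bound. -/

namespace CityConfig

variable (C : CityConfig)

theorem grid_mul : (C.K : ℝ) * (C.r + C.s) = 1 - C.r := by
  have h : 0 < C.r + C.s := add_pos_of_pos_of_nonneg C.r_pos C.s_nonneg
  rw [← C.grid, div_mul_cancel₀ _ h.ne']

theorem N_pos : 0 < C.N := by
  obtain ⟨z, hz⟩ := C.connected.nonempty
  exact Finset.card_pos.2 ⟨z, hz⟩

theorem one_le_N : (1 : ℝ) ≤ C.N := by exact_mod_cast C.N_pos

theorem step_pos : 0 < C.r + C.s := add_pos_of_pos_of_nonneg C.r_pos C.s_nonneg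

theorem square_subset_unitSquare {z : ℤ × ℤ} (hz : z ∈ C.cities) :
    C.square z ⊆ unitSquare := by
  have key : ∀ (t : ℤ), t ∈ Set.Icc (0 : ℤ) C.K → ∀ u : ℝ,
      u ∈ Set.Icc (-(1 / 2) + t * (C.r + C.s)) (-(1 / 2) + t * (C.r + C.s) + C.r) →
      u ∈ Set.Icc (-(1 / 2) : ℝ) (1 / 2) := by
    intro t ht u hu
    have h0 : (0 : ℝ) ≤ t := by exact_mod_cast ht.1
    have h1 : (t : ℝ) ≤ C.K := by exact_mod_cast ht.2
    have h2 := mul_nonneg h0 C.step_pos.le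
    have h3 := mul_le_mul_of_nonneg_right h1 C.step_pos.le
    rw [C.grid_mul] at h3
    exact ⟨by linarith [hu.1], by linarith [hu.2]⟩
  intro x hx k
  obtain ⟨hz0, hz1⟩ := C.mem_grid z hz
  fin_cases k
  · exact key z.1 hz0 _ hx.1
  · exact key z.2 hz1 _ hx.2

theorem mem_region {x : Plane} : x ∈ C.region ↔ ∃ z ∈ C.cities, x ∈ C.square z := by
  simp [region]

theorem region_subset_unitSquare : C.region ⊆ unitSquare := by
  intro x hx
  obtain ⟨z, hz, hxz⟩ := C.mem_region.1 hx
  exact C.square_subset_unitSquare hz hxz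

theorem dist_le_of_mem_square {z : ℤ × ℤ} {a b : Plane} (ha : a ∈ C.square z)
    (hb : b ∈ C.square z) : dist a b ≤ 2 * C.r := by
  refine Plane.dist_le_two_mul C.r_pos.le fun k => ?_
  obtain ⟨⟨a0, a0'⟩, a1, a1'⟩ := ha
  obtain ⟨⟨b0, b0'⟩, b1, b1'⟩ := hb
  fin_cases k <;> simp only [Fin.zero_eta, Fin.mk_one, Fin.isValue, abs_le] <;>
    constructor <;> linarith

/-- The lower left corner of the square with index `z`. -/
noncomputable def corner (z : ℤ × ℤ) : Plane :=
  !₂[-(1 / 2) + z.1 * (C.r + C.s), -(1 / 2) + z.2 * (C.r + C.s)]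

theorem corner_mem_square (z : ℤ × ℤ) : C.corner z ∈ C.square z := by
  have := C.r_pos.le
  simp [corner, square, this]

theorem dist_corner_le {z w : ℤ × ℤ} (h : latticeGraph.Adj z w) :
    dist (C.corner z) (C.corner w) ≤ 2 * (C.r + C.s) := by
  have hs := C.step_pos.le
  have key : ∀ t u : ℤ, |t - u| ≤ 1 →
      |(-(1 / 2) + t * (C.r + C.s)) - (-(1 / 2) + u * (C.r + C.s))| ≤ C.r + C.s := by
    intro t u htu
    have : |(t : ℝ) - u| ≤ 1 := by exact_mod_cast htu
    calc _ = |((t : ℝ) - u) * (C.r + C.s)| := by ring_nf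
      _ = |(t : ℝ) - u| * (C.r + C.s) := by rw [abs_mul, abs_of_nonneg hs]
      _ ≤ _ := mul_le_of_le_one_left hs this
  have h' : |z.1 - w.1| + |z.2 - w.2| = 1 := h
  refine Plane.dist_le_two_mul hs fun k => ?_
  fin_cases k
  · simpa [corner] using key z.1 w.1 (by linarith [abs_nonneg (z.2 - w.2)])
  · simpa [corner] using key z.2 w.2 (by linarith [abs_nonneg (z.1 - w.1)])

/-- Some edge of a connected graph leaves any proper non-empty set of cities; its far end joins the
tour at a cost of at most `4(r + s)`. -/
theorem exists_hasTour_corners (k : ℕ) (hk : k + 1 ≤ C.N) :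
    ∃ A ⊆ C.cities, A.card = k + 1 ∧
      HasTour (A.val.map C.corner) (4 * (k + 1 : ℝ) * (C.r + C.s)) := by
  induction k with
  | zero =>
    obtain ⟨z, hz⟩ := C.connected.nonempty
    refine ⟨{z}, by simpa using hz, by simp, ?_⟩
    have := C.step_pos.le
    exact (hasTour_singleton (C.corner z)).mono (by positivity)
  | succ k ih =>
    obtain ⟨A, hA, hcard, hT⟩ := ih (by omega)
    obtain ⟨a, ha⟩ := Finset.card_pos.1 (by omega : 0 < A.card)
    obtain ⟨b, hb, hbA⟩ := Finset.exists_mem_notMem_of_card_lt_card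
      (show A.card < C.cities.card by unfold N at hk; omega)
    obtain ⟨p⟩ := C.connected.preconnected ⟨a, hA ha⟩ ⟨b, hb⟩
    obtain ⟨d, -, hd1, hd2⟩ := p.exists_boundary_dart {v | (v : ℤ × ℤ) ∈ A} ha hbA
    have hadj : latticeGraph.Adj (d.fst : ℤ × ℤ) d.snd := d.adj
    refine ⟨insert (d.snd : ℤ × ℤ) A, ?_, ?_, ?_⟩
    · exact Finset.insert_subset d.snd.2 hA
    · rw [Finset.card_insert_of_notMem hd2, hcard]
    · rw [Finset.insert_val_of_notMem hd2, Multiset.map_cons]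
      refine (hT.insert (a := C.corner d.snd)
        (Multiset.mem_map_of_mem C.corner hd1)).mono ?_
      have := C.dist_corner_le hadj.symm
      push_cast
      linarith

theorem hasTour_corners :
    HasTour (C.cities.val.map C.corner) (4 * C.N * (C.r + C.s)) := by
  obtain ⟨k, hk⟩ := Nat.exists_eq_succ_of_ne_zero C.N_pos.ne'
  obtain ⟨A, hA, hcard, hT⟩ := C.exists_hasTour_corners k hk.ge
  rw [Finset.eq_of_subset_of_card_le hA (by rw [hcard]; exact hk.le)] at hT
  rw [hk]
  exact_mod_cast hT

theorem abs_sub_le_of_floor_eq {q : ℕ} (hq : 0 < q) {r a b c : ℝ} (hr : 0 < r) (ha : c ≤ a)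
    (hb : c ≤ b) (h : ⌊(a - c) / r * q⌋₊ = ⌊(b - c) / r * q⌋₊) : |a - b| ≤ r / q := by
  have hq' : (0 : ℝ) < q := by exact_mod_cast hq
  have key : ∀ u : ℝ, c ≤ u →
      (⌊(u - c) / r * q⌋₊ : ℝ) * (r / q) ≤ u - c ∧
        u - c ≤ (⌊(u - c) / r * q⌋₊ : ℝ) * (r / q) + r / q := by
    intro u hu
    have h0 : 0 ≤ (u - c) / r * q := by
      have := sub_nonneg.2 hu
      positivity
    have h1 := Nat.floor_le h0
    have h2 := (Nat.lt_floor_add_one ((u - c) / r * q)).le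
    have e : (u - c) / r * q * (r / q) = u - c := by field_simp
    have hrq : 0 ≤ r / q := by positivity
    have h3 := mul_le_mul_of_nonneg_right h1 hrq
    have h4 := mul_le_mul_of_nonneg_right h2 hrq
    rw [e] at h3 h4
    exact ⟨h3, by linarith⟩
  have hA := key a ha
  have hB := key b hb
  rw [h] at hA
  rw [abs_le]
  constructor <;> linarith [hA.1, hA.2, hB.1, hB.2]

/-- Pigeonhole: among many points of the region two are close to each other. -/
theorem exists_dist_le {m q : ℕ} (hq : 0 < q) (hm : C.N * (q + 1) ^ 2 < m) (x : Fin m → Plane)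
    (hx : ∀ i, x i ∈ C.region) : ∃ i j, i ≠ j ∧ dist (x i) (x j) ≤ 2 * (C.r / q) := by
  have hr := C.r_pos
  choose z hz hxz using fun i => C.mem_region.1 (hx i)
  let g : Fin m → (ℤ × ℤ) × ℕ × ℕ := fun i =>
    (z i, ⌊(x i 0 - (-(1 / 2) + (z i).1 * (C.r + C.s))) / C.r * q⌋₊,
      ⌊(x i 1 - (-(1 / 2) + (z i).2 * (C.r + C.s))) / C.r * q⌋₊)
  -- The squares are closed, so the floor can equal `q`: hence `q + 1` values per axis.
  have hfl : ∀ c u : ℝ, u ∈ Set.Icc c (c + C.r) → ⌊(u - c) / C.r * q⌋₊ < q + 1 := by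
    intro c u hu
    rw [Nat.lt_succ_iff]
    apply Nat.floor_le_of_le
    have : (u - c) / C.r ≤ 1 := by rw [div_le_one hr]; linarith [hu.2]
    exact mul_le_of_le_one_left (Nat.cast_nonneg q) this
  obtain ⟨i, -, j, -, hij, hg⟩ := Finset.exists_ne_map_eq_of_card_lt_of_maps_to
    (s := (Finset.univ : Finset (Fin m))) (f := g)
    (t := C.cities ×ˢ Finset.range (q + 1) ×ˢ Finset.range (q + 1))
    (by
      rw [Finset.card_product, Finset.card_product, Finset.card_range, Finset.card_univ,
        Fintype.card_fin, ← sq]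
      exact hm)
    (fun i _ => by
      simp only [Finset.coe_product, Set.mem_prod, Finset.mem_coe, Finset.mem_range, g]
      exact ⟨hz i, hfl _ _ (hxz i).1, hfl _ _ (hxz i).2⟩)
  simp only [g, Prod.mk.injEq] at hg
  obtain ⟨hzz, h0, h1⟩ := hg
  refine ⟨i, j, hij, Plane.dist_le_two_mul (by positivity) fun k => ?_⟩
  have hi := hxz i
  have hj := hxz j
  rw [hzz] at h0 h1 hi
  fin_cases k
  · exact abs_sub_le_of_floor_eq hq hr hi.1.1 hj.1.1 h0
  · exact abs_sub_le_of_floor_eq hq hr hi.2.1 hj.2.1 h1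

/-- With `D = ⌊√⌊k/N⌋⌋`, one has `N D² ≤ k < N (D + 1)²`. If `D ≤ 1`, the corner of the point's own
city is near enough. Otherwise the pigeonhole applies with `q = D - 1`, and `D + 1 ≤ 3q` gives the
constant `6`. -/
theorem exists_near_point {k : ℕ} (x : Fin (k + 1) → Plane) (hx : ∀ i, x i ∈ C.region) :
    ∃ i, ∃ p ∈ (Finset.univ.val.map fun j => x (i.succAbove j)) + C.cities.val.map C.corner,
      dist (x i) p * √(k + 1 : ℝ) ≤ 6 * C.r * √(C.N : ℝ) := by
  have hr := C.r_pos
  have hN := C.N_pos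
  set D := Nat.sqrt (k / C.N) with hD
  have hlow : C.N * D ^ 2 ≤ k :=
    (Nat.mul_le_mul_left _ (by rw [hD, sq]; exact Nat.sqrt_le _)).trans (Nat.mul_div_le k C.N)
  have hup : k + 1 ≤ C.N * (D + 1) ^ 2 := by
    have : k / C.N < (D + 1) ^ 2 := by rw [hD, sq]; exact Nat.lt_succ_sqrt _
    rw [Nat.div_lt_iff_lt_mul hN] at this
    rw [mul_comm]
    exact this
  have hup' : √(k + 1 : ℝ) ≤ √(C.N : ℝ) * (D + 1) := by
    rw [Real.sqrt_le_left (by positivity), mul_pow, Real.sq_sqrt (Nat.cast_nonneg _)]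
    exact_mod_cast hup
  rcases lt_or_ge D 2 with h | h
  · obtain ⟨z, hz, hxz⟩ := C.mem_region.1 (hx 0)
    refine ⟨0, C.corner z, Multiset.mem_add.2 (Or.inr (Multiset.mem_map_of_mem _ hz)), ?_⟩
    have h1 : (D : ℝ) ≤ 1 := by exact_mod_cast Nat.lt_succ_iff.1 h
    have h2 := C.dist_le_of_mem_square hxz (C.corner_mem_square z)
    have h3 : √(k + 1 : ℝ) ≤ √(C.N : ℝ) * 2 :=
      hup'.trans (mul_le_mul_of_nonneg_left (by linarith) (Real.sqrt_nonneg _))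
    calc _ ≤ (2 * C.r) * (√(C.N : ℝ) * 2) := by gcongr
      _ ≤ _ := by nlinarith [mul_nonneg hr.le (Real.sqrt_nonneg (C.N : ℝ))]
  · obtain ⟨q, hq⟩ : ∃ q, D = q + 1 := ⟨D - 1, by omega⟩
    have hq0 : 0 < q := by omega
    rw [hq] at hlow hup'
    obtain ⟨i, j, hij, hd⟩ := C.exists_dist_le hq0 (Nat.lt_succ_of_le hlow) x hx
    obtain ⟨j, rfl⟩ := Fin.exists_succAbove_eq hij.symm
    refine ⟨i, x (i.succAbove j), Multiset.mem_add.2 (Or.inl (Multiset.mem_map_of_mem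
      (fun j => x (i.succAbove j)) (Finset.mem_univ j))), ?_⟩
    have hq1 : (1 : ℝ) ≤ q := by exact_mod_cast hq0
    have h3 : √(k + 1 : ℝ) ≤ √(C.N : ℝ) * (3 * q) :=
      hup'.trans (mul_le_mul_of_nonneg_left (by push_cast; linarith) (Real.sqrt_nonneg _))
    calc _ ≤ (2 * (C.r / q)) * (√(C.N : ℝ) * (3 * q)) := by gcongr
      _ = _ := by field_simp; ring

/-- The corners stay in the tour throughout, so that a near neighbour is available even when few
points are present. -/
theorem hasTour_add_corners {k : ℕ} (x : Fin k → Plane) (hx : ∀ i, x i ∈ C.region) :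
    HasTour (Finset.univ.val.map x + C.cities.val.map C.corner)
      (4 * C.N * (C.r + C.s) + 24 * C.r * √(C.N : ℝ) * √(k : ℝ)) := by
  induction k with
  | zero => simpa using C.hasTour_corners
  | succ k ih =>
    obtain ⟨i, p, hp, hd⟩ := C.exists_near_point x hx
    rw [univ_val_map_succAbove x i, Multiset.cons_add]
    refine ((ih _ fun j => hx (i.succAbove j)).insert hp).mono ?_
    set u := √(k : ℝ)
    set v := √(k + 1 : ℝ)
    have hv : 0 < v := Real.sqrt_pos.2 (by positivity)
    have hu : 0 ≤ u := Real.sqrt_nonneg _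
    have huv : v ^ 2 = u ^ 2 + 1 := by
      rw [Real.sq_sqrt (by positivity), Real.sq_sqrt (by positivity)]
    -- That is `1/v ≤ 2(v - u)`: the insertion cost `12 r √N / v` is dominated by a telescoping
    -- difference.
    have h1 : 1 ≤ 2 * v * (v - u) := by nlinarith [sq_nonneg (v - u)]
    have hA : 0 ≤ C.r * √(C.N : ℝ) := mul_nonneg C.r_pos.le (Real.sqrt_nonneg _)
    have h2 : dist (x i) p * v ≤ (12 * (C.r * √(C.N : ℝ)) * (v - u)) * v := by
      nlinarith [mul_le_mul_of_nonneg_left h1 hA]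
    have h3 := le_of_mul_le_mul_right h2 hv
    push_cast
    linarith

/-- Deterministic upper bound for the shortest tour of points in the region. -/
theorem tspLength_le {n : ℕ} (x : Fin n → Plane) (hx : ∀ i, x i ∈ C.region) :
    tspLength x ≤ 4 * C.N * (C.r + C.s) + 24 * C.scale n := by
  rw [tspLength_le_iff_hasTour]
  have h := C.hasTour_add_corners x hx
  rw [add_comm] at h
  refine h.of_add.mono (le_of_eq ?_)
  rw [scale, mul_comm (n : ℝ), Real.sqrt_mul (Nat.cast_nonneg _)]
  ring

end CityConfig

/-! ### Areas and the law of a node. -/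

theorem Plane.volume_preimage_pi (s : Fin 2 → Set ℝ) (hs : ∀ k, MeasurableSet (s k)) :
    volume {x : Plane | ∀ k, x k ∈ s k} = volume (s 0) * volume (s 1) := by
  have h : {x : Plane | ∀ k, x k ∈ s k} = WithLp.ofLp ⁻¹' (Set.univ.pi s) := by
    ext x; simp
  rw [h, (PiLp.volume_preserving_ofLp (Fin 2)).measure_preimage
    (MeasurableSet.univ_pi hs).nullMeasurableSet, volume_pi_pi, Fin.prod_univ_two]

theorem Plane.measurableSet_preimage_pi (s : Fin 2 → Set ℝ) (hs : ∀ k, MeasurableSet (s k)) :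
    MeasurableSet {x : Plane | ∀ k, x k ∈ s k} := by
  have h : {x : Plane | ∀ k, x k ∈ s k} = WithLp.ofLp ⁻¹' (Set.univ.pi s) := by
    ext x; simp
  rw [h]
  exact (PiLp.volume_preserving_ofLp (Fin 2)).measurable (MeasurableSet.univ_pi hs)

theorem volume_unitSquare : volume unitSquare = 1 := by
  refine (Plane.volume_preimage_pi (fun _ => Set.Icc (-(1 / 2) : ℝ) (1 / 2))
    fun _ => measurableSet_Icc).trans ?_
  simp only [Real.volume_Icc]
  norm_num

namespace CityConfig

variable (C : CityConfig)

theorem square_eq (z : ℤ × ℤ) : C.square z = {x : Plane | ∀ k,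
    x k ∈ (![Set.Icc (-(1 / 2) + z.1 * (C.r + C.s)) (-(1 / 2) + z.1 * (C.r + C.s) + C.r),
      Set.Icc (-(1 / 2) + z.2 * (C.r + C.s)) (-(1 / 2) + z.2 * (C.r + C.s) + C.r)] :
      Fin 2 → Set ℝ) k} := by
  ext x
  simp [square, Fin.forall_fin_two]

/-- The square of the tiling with its upper and right sides removed. -/
def halfOpenSquare (z : ℤ × ℤ) : Set Plane := {x : Plane | ∀ k,
    x k ∈ (![Set.Ico (-(1 / 2) + z.1 * (C.r + C.s)) (-(1 / 2) + z.1 * (C.r + C.s) + C.r),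
      Set.Ico (-(1 / 2) + z.2 * (C.r + C.s)) (-(1 / 2) + z.2 * (C.r + C.s) + C.r)] :
      Fin 2 → Set ℝ) k}

theorem halfOpenSquare_subset (z : ℤ × ℤ) : C.halfOpenSquare z ⊆ C.square z := by
  intro x hx
  exact ⟨Set.Ico_subset_Icc_self (hx 0), Set.Ico_subset_Icc_self (hx 1)⟩

theorem measurableSet_square (z : ℤ × ℤ) : MeasurableSet (C.square z) := by
  rw [square_eq]
  refine Plane.measurableSet_preimage_pi _ fun k => ?_
  fin_cases k <;> exact measurableSet_Icc

theorem measurableSet_halfOpenSquare (z : ℤ × ℤ) : MeasurableSet (C.halfOpenSquare z) := by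
  refine Plane.measurableSet_preimage_pi _ fun k => ?_
  fin_cases k <;> exact measurableSet_Ico

theorem volume_square (z : ℤ × ℤ) : volume (C.square z) = ENNReal.ofReal (C.r ^ 2) := by
  rw [square_eq, Plane.volume_preimage_pi _ fun k => by fin_cases k <;> exact measurableSet_Icc,
    sq, ENNReal.ofReal_mul C.r_pos.le]
  simp

theorem volume_halfOpenSquare (z : ℤ × ℤ) :
    volume (C.halfOpenSquare z) = ENNReal.ofReal (C.r ^ 2) := by
  rw [halfOpenSquare,
    Plane.volume_preimage_pi _ fun k => by fin_cases k <;> exact measurableSet_Ico,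
    sq, ENNReal.ofReal_mul C.r_pos.le]
  simp

/-- When `s = 0` adjacent closed squares share a side, so additivity of area is applied to the
half-open ones. -/
theorem pairwise_disjoint_halfOpenSquare : Pairwise (Function.onFun Disjoint C.halfOpenSquare) := by
  have key : ∀ t u : ℤ, ∀ a : ℝ,
      a ∈ Set.Ico (-(1 / 2) + t * (C.r + C.s)) (-(1 / 2) + t * (C.r + C.s) + C.r) →
      a ∈ Set.Ico (-(1 / 2) + u * (C.r + C.s)) (-(1 / 2) + u * (C.r + C.s) + C.r) → t ≤ u := by
    intro t u a ht hu
    by_contra! h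
    have h1 : (u : ℝ) + 1 ≤ t := by exact_mod_cast h
    have h2 := mul_le_mul_of_nonneg_right h1 C.step_pos.le
    linarith [ht.1, hu.2, C.s_nonneg]
  intro z w hzw
  refine Set.disjoint_left.2 fun x hz hw => hzw ?_
  exact Prod.ext (le_antisymm (key _ _ _ (hz 0) (hw 0)) (key _ _ _ (hw 0) (hz 0)))
    (le_antisymm (key _ _ _ (hz 1) (hw 1)) (key _ _ _ (hw 1) (hz 1)))

theorem measurableSet_region : MeasurableSet C.region :=
  C.cities.measurableSet_biUnion fun z _ => C.measurableSet_square z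

theorem volume_region : volume C.region = ENNReal.ofReal (C.N * C.r ^ 2) := by
  have e : ENNReal.ofReal (C.N * C.r ^ 2) = C.N * ENNReal.ofReal (C.r ^ 2) := by
    rw [ENNReal.ofReal_mul (Nat.cast_nonneg _), ENNReal.ofReal_natCast]
  rw [e]
  apply le_antisymm
  · refine (measure_biUnion_finset_le C.cities C.square).trans ?_
    simp [volume_square, N]
  · calc (C.N : ENNReal) * ENNReal.ofReal (C.r ^ 2)
        = ∑ z ∈ C.cities, volume (C.halfOpenSquare z) := by simp [volume_halfOpenSquare, N]
      _ = volume (⋃ z ∈ C.cities, C.halfOpenSquare z) :=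
          (measure_biUnion_finset (C.pairwise_disjoint_halfOpenSquare.set_pairwise _)
            fun z _ => C.measurableSet_halfOpenSquare z).symm
      _ ≤ volume C.region :=
          measure_mono (Set.iUnion₂_mono fun z _ => C.halfOpenSquare_subset z)

theorem volume_real_region : volume.real C.region = C.N * C.r ^ 2 := by
  rw [Measure.real, volume_region, ENNReal.toReal_ofReal (by positivity)]

theorem area_pos : 0 < C.N * C.r ^ 2 := by
  have := C.one_le_N
  have := C.r_pos
  positivity

theorem area_le_one : C.N * C.r ^ 2 ≤ 1 := by
  have h := measure_mono (μ := volume) C.region_subset_unitSquare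
  rw [volume_unitSquare, volume_region] at h
  exact ENNReal.ofReal_le_one.1 h

section Law

variable {f : Plane → ℝ} {ε₁ ε₂ : ℝ}

theorem integral_region_bounds (hf : ∀ x ∈ unitSquare, ε₁ ≤ f x ∧ f x ≤ ε₂)
    (hint : IntegrableOn f unitSquare) :
    ε₁ * (C.N * C.r ^ 2) ≤ ∫ x in C.region, f x ∧
      ∫ x in C.region, f x ≤ ε₂ * (C.N * C.r ^ 2) := by
  have hfin : volume C.region ≠ ⊤ := by rw [volume_region]; exact ENNReal.ofReal_ne_top
  have hi : IntegrableOn f C.region := hint.mono_set C.region_subset_unitSquare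
  have hc : ∀ c : ℝ, ∫ _ in C.region, c = c * (C.N * C.r ^ 2) := fun c => by
    rw [setIntegral_const, volume_real_region, smul_eq_mul, mul_comm]
  rw [← hc, ← hc]
  exact ⟨setIntegral_mono_on (integrableOn_const hfin) hi C.measurableSet_region
      fun x hx => (hf x (C.region_subset_unitSquare hx)).1,
    setIntegral_mono_on hi (integrableOn_const hfin) C.measurableSet_region
      fun x hx => (hf x (C.region_subset_unitSquare hx)).2⟩

/-- The law of a node. -/
noncomputable def law (f : Plane → ℝ) : Measure Plane :=
  volume.withDensity fun x => ENNReal.ofReal (C.density f x)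

theorem law_compl_region : C.law f C.regionᶜ = 0 := by
  rw [law, withDensity_apply _ C.measurableSet_region.compl]
  refine (setLIntegral_congr_fun C.measurableSet_region.compl fun x hx => ?_).trans
    (lintegral_zero (μ := volume.restrict C.regionᶜ))
  simp [density, Set.indicator_of_notMem hx]

theorem law_le (hε₁ : 0 < ε₁) (hf : ∀ x ∈ unitSquare, ε₁ ≤ f x ∧ f x ≤ ε₂)
    (hint : IntegrableOn f unitSquare) :
    C.law f ≤ ENNReal.ofReal (ε₂ / ε₁ / (C.N * C.r ^ 2)) • volume := by
  rw [← withDensity_const]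
  refine withDensity_mono (Eventually.of_forall fun x => ENNReal.ofReal_le_ofReal ?_)
  have hZ := (C.integral_region_bounds hf hint).1
  have hA := C.area_pos
  rw [density, div_div]
  by_cases hx : x ∈ C.region
  · rw [Set.indicator_of_mem hx]
    have h := hf x (C.region_subset_unitSquare hx)
    exact div_le_div₀ (hε₁.le.trans (h.1.trans h.2)) h.2 (by positivity) hZ
  · rw [Set.indicator_of_notMem hx]
    -- The sign of `ε₂` is read off from the bounds on `f` at any point of a city.
    obtain ⟨z, hz⟩ := C.connected.nonempty
    have h := hf _ (C.square_subset_unitSquare hz (C.corner_mem_square z))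
    have : 0 ≤ ε₂ := hε₁.le.trans (h.1.trans h.2)
    positivity

theorem le_law_square (hε₁ : 0 < ε₁) (hf : ∀ x ∈ unitSquare, ε₁ ≤ f x ∧ f x ≤ ε₂)
    (hint : IntegrableOn f unitSquare) {z : ℤ × ℤ} (hz : z ∈ C.cities) :
    ENNReal.ofReal (ε₁ / ε₂ / C.N) ≤ C.law f (C.square z) := by
  have hA := C.area_pos
  have hr := C.r_pos
  have hN := C.one_le_N
  obtain ⟨hZ1, hZ2⟩ := C.integral_region_bounds hf hint
  have hZ : 0 < ∫ x in C.region, f x := (by positivity : 0 < ε₁ * (C.N * C.r ^ 2)).trans_le hZ1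
  rw [law, withDensity_apply _ (C.measurableSet_square z)]
  calc ENNReal.ofReal (ε₁ / ε₂ / C.N)
      = ENNReal.ofReal (ε₁ / (ε₂ * (C.N * C.r ^ 2))) * volume (C.square z) := by
        rw [volume_square, ← ENNReal.ofReal_mul' (by positivity)]
        congr 1
        field_simp
    _ = ∫⁻ _ in C.square z, ENNReal.ofReal (ε₁ / (ε₂ * (C.N * C.r ^ 2))) := by
        rw [setLIntegral_const]
    _ ≤ _ := by
        refine setLIntegral_mono' (C.measurableSet_square z) fun x hx =>
          ENNReal.ofReal_le_ofReal ?_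
        rw [density, Set.indicator_of_mem (C.mem_region.2 ⟨z, hz, hx⟩)]
        have h := hf x (C.square_subset_unitSquare hz hx)
        exact div_le_div₀ (hε₁.le.trans h.1) h.1 hZ hZ2

end Law

end CityConfig

/-! ### The Chernoff lower bound. -/

theorem lintegral_exp_neg_mul_abs {c : ℝ} (hc : 0 < c) :
    ∫⁻ t : ℝ, ENNReal.ofReal (Real.exp (-c * |t|)) = ENNReal.ofReal (2 / c) := by
  have h : ∫ t : ℝ, Real.exp (-c * |t|) = 2 / c := by
    rw [integral_comp_abs (f := fun t => Real.exp (-c * t)),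
      integral_exp_mul_Ioi (by linarith) 0]
    simp [div_eq_mul_inv]
  have hi : Integrable fun t : ℝ => Real.exp (-c * |t|) := by
    -- A non-integrable function would have Bochner integral `0`, not `2 / c`.
    by_contra hn
    rw [integral_undef hn] at h
    have : 0 < 2 / c := by positivity
    linarith
  rw [← h, ofReal_integral_eq_lintegral_ofReal hi (Eventually.of_forall fun t => (Real.exp_pos _).le)]

theorem Plane.lintegral_mul (f g : ℝ → ENNReal) (hf : Measurable f) (hg : Measurable g) :
    ∫⁻ y : Plane, f (y 0) * g (y 1) = (∫⁻ t, f t) * ∫⁻ t, g t := by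
  have h := (volume_preserving_finTwoArrow ℝ).comp (PiLp.volume_preserving_ofLp (Fin 2))
  have h2 := h.lintegral_comp (f := fun p : ℝ × ℝ => f p.1 * g p.2) (by fun_prop)
  rw [← lintegral_prod_mul hf.aemeasurable hg.aemeasurable]
  exact h2

/-- The distance is at least the mean of the two coordinate differences, so the integral is bounded
by a product of two one-dimensional ones, each `4 / c`. -/
theorem Plane.lintegral_exp_neg_dist_le {c : ℝ} (hc : 0 < c) (x : Plane) :
    ∫⁻ y : Plane, ENNReal.ofReal (Real.exp (-c * dist x y)) ≤ ENNReal.ofReal (16 / c ^ 2) := by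
  have hk : ∀ (y : Plane) (k : Fin 2), |x k - y k| ≤ dist x y := fun y k => by
    rw [dist_eq_norm]
    exact PiLp.norm_apply_le (x - y) k
  have h1 : ∀ u : ℝ, ∫⁻ t : ℝ, ENNReal.ofReal (Real.exp (-(c / 2) * |u - t|)) =
      ENNReal.ofReal (4 / c) := fun u => by
    rw [lintegral_sub_left_eq_self (fun t => ENNReal.ofReal (Real.exp (-(c / 2) * |t|))) u,
      lintegral_exp_neg_mul_abs (by positivity)]
    congr 1
    field_simp
    norm_num
  calc ∫⁻ y : Plane, ENNReal.ofReal (Real.exp (-c * dist x y))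
      ≤ ∫⁻ y : Plane, ENNReal.ofReal (Real.exp (-(c / 2) * |x 0 - y 0|)) *
          ENNReal.ofReal (Real.exp (-(c / 2) * |x 1 - y 1|)) := by
        refine lintegral_mono fun y => ?_
        rw [← ENNReal.ofReal_mul (Real.exp_pos _).le, ← Real.exp_add]
        refine ENNReal.ofReal_le_ofReal (Real.exp_le_exp.2 ?_)
        nlinarith [hk y 0, hk y 1]
    _ = ENNReal.ofReal (4 / c) * ENNReal.ofReal (4 / c) := by
        rw [Plane.lintegral_mul (fun t => ENNReal.ofReal (Real.exp (-(c / 2) * |x 0 - t|)))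
          (fun t => ENNReal.ofReal (Real.exp (-(c / 2) * |x 1 - t|))) (by fun_prop)
          (by fun_prop), h1, h1]
    _ = ENNReal.ofReal (16 / c ^ 2) := by
        rw [← ENNReal.ofReal_mul (by positivity)]
        congr 1
        field_simp
        norm_num

section Pi

variable {E : Type*} [MeasurableSpace E]

theorem measurePreserving_consEquiv (μ : Measure E) [SigmaFinite μ] (n : ℕ) :
    MeasurePreserving (fun p : E × (Fin n → E) => (Fin.cons p.1 p.2 : Fin (n + 1) → E))
      (μ.prod (Measure.pi fun _ => μ)) (Measure.pi fun _ => μ) := by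
  have h := (measurePreserving_piFinSuccAbove (fun _ : Fin (n + 1) => μ) 0).symm
  convert h using 1
  ext p i
  simp [MeasurableEquiv.piFinSuccAbove, Fin.insertNthEquiv]

theorem lintegral_pi_succ (μ : Measure E) [SigmaFinite μ] {n : ℕ} {F : (Fin (n + 1) → E) → ENNReal}
    (hF : Measurable F) :
    ∫⁻ x, F x ∂Measure.pi (fun _ => μ) =
      ∫⁻ a, ∫⁻ y, F (Fin.cons a y) ∂Measure.pi (fun _ => μ) ∂μ := by
  have h := measurePreserving_consEquiv μ n
  rw [← h.lintegral_comp hF]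
  exact lintegral_prod _ (hF.comp h.measurable).aemeasurable

theorem measurePreserving_comp_perm (μ : Measure E) [SigmaFinite μ] {n : ℕ}
    (σ : Equiv.Perm (Fin n)) :
    MeasurePreserving (fun x : Fin n → E => fun i => x (σ i))
      (Measure.pi fun _ => μ) (Measure.pi fun _ => μ) := by
  have h := measurePreserving_piCongrLeft (fun _ : Fin n => μ) σ.symm
  convert h using 1
  ext x i
  simp [MeasurableEquiv.piCongrLeft, Equiv.piCongrLeft, Equiv.piCongrLeft']

end Pi

/-- Length of the open path visiting the nodes in order. -/
noncomputable def openPathLength {m : ℕ} (y : Fin (m + 1) → Plane) : ℝ :=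
  ∑ i : Fin m, dist (y i.castSucc) (y i.succ)

theorem measurable_openPathLength (m : ℕ) :
    Measurable fun y : Fin (m + 1) → Plane => openPathLength y := by
  unfold openPathLength
  fun_prop

theorem openPathLength_cons {m : ℕ} (a : Plane) (y : Fin (m + 1) → Plane) :
    openPathLength (Fin.cons a y : Fin (m + 2) → Plane) = dist a (y 0) + openPathLength y := by
  simp only [openPathLength]
  rw [Fin.sum_univ_succ]
  simp only [Fin.castSucc_zero, Fin.cons_zero, Fin.cons_succ, ← Fin.succ_castSucc]

/-- Without the closing edge, nodes can be integrated out one at a time. -/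
theorem openPathLength_le_tourLength {m : ℕ} (x : Fin (m + 1) → Plane)
    (σ : Equiv.Perm (Fin (m + 1))) : openPathLength (fun i => x (σ i)) ≤ tourLength x σ := by
  rw [tourLength, Fin.sum_univ_castSucc, openPathLength]
  simp only [finRotate_apply, Fin.coeSucc_eq_succ]
  exact le_add_of_nonneg_right dist_nonneg

/-- The one-step bound `A` is uniform in the starting point, so each of the `m` steps contributes a
factor `A` whatever the previous node. -/
theorem lintegral_exp_neg_openPathLength_le (μ : Measure Plane) [IsProbabilityMeasure μ] {c : ℝ}
    {A : ENNReal} (hA : ∀ x, ∫⁻ y, ENNReal.ofReal (Real.exp (-c * dist x y)) ∂μ ≤ A) (m : ℕ)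
    (a : Plane) :
    ∫⁻ y, ENNReal.ofReal (Real.exp (-c * openPathLength (Fin.cons a y : Fin (m + 1) → Plane)))
      ∂Measure.pi (fun _ => μ) ≤ A ^ m := by
  have hmeas : ∀ (m : ℕ) (a : Plane), Measurable fun y : Fin m → Plane =>
      ENNReal.ofReal (Real.exp (-c * openPathLength (Fin.cons a y : Fin (m + 1) → Plane))) := by
    intro m a
    have h1 := measurable_openPathLength m
    have h2 : Measurable fun y : Fin m → Plane => (Fin.cons a y : Fin (m + 1) → Plane) :=
      (measurePreserving_consEquiv μ m).measurable.comp measurable_prodMk_left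
    have h3 := h1.comp h2
    exact (Real.measurable_exp.comp (h3.const_mul (-c))).ennreal_ofReal
  induction m generalizing a with
  | zero => simp [openPathLength]
  | succ m ih =>
    rw [lintegral_pi_succ μ (hmeas (m + 1) a)]
    have e : ∀ (b : Plane) (y : Fin m → Plane),
        ENNReal.ofReal (Real.exp (-c * openPathLength
          (Fin.cons a (Fin.cons b y : Fin (m + 1) → Plane) : Fin (m + 2) → Plane))) =
        ENNReal.ofReal (Real.exp (-c * dist a b)) * ENNReal.ofReal (Real.exp (-c * openPathLength
          (Fin.cons b y : Fin (m + 1) → Plane))) := by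
      intro b y
      rw [openPathLength_cons, Fin.cons_zero, mul_add, Real.exp_add,
        ENNReal.ofReal_mul (Real.exp_pos _).le]
    simp only [e]
    calc _ ≤ ∫⁻ b, ENNReal.ofReal (Real.exp (-c * dist a b)) * A ^ m ∂μ := by
          refine lintegral_mono fun b => ?_
          rw [lintegral_const_mul _ (hmeas m b)]
          exact mul_le_mul_right (ih b) _
      _ = (∫⁻ b, ENNReal.ofReal (Real.exp (-c * dist a b)) ∂μ) * A ^ m :=
          lintegral_mul_const _ (by fun_prop)
      _ ≤ A * A ^ m := mul_le_mul_left (hA a) _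
      _ = A ^ (m + 1) := (pow_succ' A m).symm

/-- A Chernoff bound with a union bound over all orderings: the shortest tour through
independent nodes of bounded density is unlikely to be short. -/
theorem measure_tspLength_lt_le (μ : Measure Plane) [IsProbabilityMeasure μ] {D : ℝ} (hD : 0 ≤ D)
    (hμ : μ ≤ ENNReal.ofReal D • volume) {c : ℝ} (hc : 0 < c) (L : ℝ) (m : ℕ) :
    Measure.pi (fun _ : Fin (m + 1) => μ) {x | tspLength x < L} ≤
      ENNReal.ofReal ((m + 1).factorial * (Real.exp (c * L) * (D * (16 / c ^ 2)) ^ m)) := by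
  set ν := Measure.pi (fun _ : Fin (m + 1) => μ)
  have hA : ∀ x, ∫⁻ y, ENNReal.ofReal (Real.exp (-c * dist x y)) ∂μ ≤
      ENNReal.ofReal (D * (16 / c ^ 2)) := fun x =>
    calc _ ≤ ∫⁻ y, ENNReal.ofReal (Real.exp (-c * dist x y)) ∂(ENNReal.ofReal D • volume) :=
          lintegral_mono' hμ le_rfl
      _ = ENNReal.ofReal D * ∫⁻ y, ENNReal.ofReal (Real.exp (-c * dist x y)) := by
          rw [lintegral_smul_measure, smul_eq_mul]
      _ ≤ ENNReal.ofReal D * ENNReal.ofReal (16 / c ^ 2) :=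
          mul_le_mul_right (Plane.lintegral_exp_neg_dist_le hc x) _
      _ = _ := (ENNReal.ofReal_mul hD).symm
  have hG : Measurable fun y : Fin (m + 1) → Plane =>
      ENNReal.ofReal (Real.exp (-c * openPathLength y)) :=
    (Real.measurable_exp.comp ((measurable_openPathLength m).const_mul (-c))).ennreal_ofReal
  have hpath : ν {y | openPathLength y < L} ≤
      ENNReal.ofReal (Real.exp (c * L) * (D * (16 / c ^ 2)) ^ m) := by
    have h1 : ∫⁻ y, ENNReal.ofReal (Real.exp (-c * openPathLength y)) ∂ν ≤
        ENNReal.ofReal (D * (16 / c ^ 2)) ^ m := by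
      rw [lintegral_pi_succ μ hG]
      refine (lintegral_mono fun a => lintegral_exp_neg_openPathLength_le μ hA m a).trans ?_
      simp
    -- Markov's inequality for the exponential.
    have h2 := meas_ge_le_lintegral_div (μ := ν) hG.aemeasurable
      (ε := ENNReal.ofReal (Real.exp (-(c * L)))) (by simp [Real.exp_pos]) ENNReal.ofReal_ne_top
    refine (measure_mono fun y hy => ?_).trans (h2.trans ?_)
    · refine ENNReal.ofReal_le_ofReal (Real.exp_le_exp.2 ?_)
      have := mul_le_mul_of_nonneg_left (le_of_lt hy) hc.le
      linarith
    · rw [ENNReal.div_eq_inv_mul, ← ENNReal.ofReal_inv_of_pos (Real.exp_pos _), ← Real.exp_neg,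
        neg_neg, ENNReal.ofReal_mul (Real.exp_pos _).le, ENNReal.ofReal_pow (by positivity)]
      exact mul_le_mul_right h1 _
  have hmeas : MeasurableSet {y : Fin (m + 1) → Plane | openPathLength y < L} :=
    measurableSet_lt (measurable_openPathLength m) measurable_const
  -- Union bound: an optimal ordering has a short open path, and by exchangeability all orderings
  -- are equally likely to have one.
  have hsub : {x : Fin (m + 1) → Plane | tspLength x < L} ⊆
      ⋃ σ ∈ (Finset.univ : Finset (Equiv.Perm (Fin (m + 1)))),
        (fun x : Fin (m + 1) → Plane => fun i => x (σ i)) ⁻¹' {y | openPathLength y < L} := by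
    intro x hx
    obtain ⟨σ, hσ⟩ := exists_tourLength_eq x
    simp only [Finset.mem_univ, Set.iUnion_true, Set.mem_iUnion]
    exact ⟨σ, ((openPathLength_le_tourLength x σ).trans_eq hσ).trans_lt hx⟩
  calc ν {x | tspLength x < L}
      ≤ ∑ σ : Equiv.Perm (Fin (m + 1)),
          ν ((fun x : Fin (m + 1) → Plane => fun i => x (σ i)) ⁻¹' {y | openPathLength y < L}) :=
        (measure_mono hsub).trans (measure_biUnion_finset_le _ _)
    _ = ∑ σ : Equiv.Perm (Fin (m + 1)), ν {y | openPathLength y < L} :=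
        Finset.sum_congr rfl fun σ _ =>
          (measurePreserving_comp_perm μ σ).measure_preimage hmeas.nullMeasurableSet
    _ = (m + 1).factorial * ν {y | openPathLength y < L} := by
        simp [Fintype.card_perm]
    _ ≤ _ := by
        rw [ENNReal.ofReal_mul (Nat.cast_nonneg _), ENNReal.ofReal_natCast]
        exact mul_le_mul_right hpath _

/-! ### The Efron–Stein inequality. -/

section EfronStein

theorem integrable_of_abs_le {α : Type*} [MeasurableSpace α] {μ : Measure α} [IsFiniteMeasure μ]
    {f : α → ℝ} {B : ℝ} (hf : Measurable f) (hB : ∀ x, |f x| ≤ B) : Integrable f μ :=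
  .of_bound hf.aestronglyMeasurable B (ae_of_all _ hB)

theorem integrable_sq_of_abs_le {α : Type*} [MeasurableSpace α] {μ : Measure α}
    [IsFiniteMeasure μ] {f : α → ℝ} {B : ℝ} (hf : Measurable f) (hB : ∀ x, |f x| ≤ B) :
    Integrable (fun x => f x ^ 2) μ :=
  integrable_of_abs_le (B := B ^ 2) (hf.pow_const 2) fun x => by
    rw [abs_pow]
    exact pow_le_pow_left₀ (abs_nonneg _) (hB x) 2

theorem abs_integral_le_of_abs_le {α : Type*} [MeasurableSpace α] {μ : Measure α}
    [IsProbabilityMeasure μ] {f : α → ℝ} {B : ℝ} (hB : ∀ x, |f x| ≤ B) : |∫ x, f x ∂μ| ≤ B := by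
  have h := norm_integral_le_of_norm_le_const (μ := μ) (ae_of_all _ hB : ∀ᵐ x ∂μ, ‖f x‖ ≤ B)
  simpa using h

/-- The mean minimises the mean square deviation from a constant. -/
theorem integral_sq_sub_sq_integral_le {α : Type*} [MeasurableSpace α] {μ : Measure α}
    [IsProbabilityMeasure μ] {f : α → ℝ} {B : ℝ} (hf : Measurable f) (hB : ∀ x, |f x| ≤ B)
    (c : ℝ) : ∫ x, f x ^ 2 ∂μ - (∫ x, f x ∂μ) ^ 2 ≤ ∫ x, (f x - c) ^ 2 ∂μ := by
  have h1 := integrable_of_abs_le (μ := μ) hf hB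
  have h2 := integrable_sq_of_abs_le (μ := μ) hf hB
  have e : ∫ x, (f x - c) ^ 2 ∂μ = ∫ x, f x ^ 2 ∂μ - 2 * c * ∫ x, f x ∂μ + c ^ 2 := by
    calc ∫ x, (f x - c) ^ 2 ∂μ = ∫ x, (f x ^ 2 - 2 * c * f x + c ^ 2) ∂μ := by
          congr 1; ext x; ring
      _ = _ := by
          have h3 : Integrable (fun x => 2 * c * f x) μ := h1.const_mul _
          have h4 : Integrable (fun x => f x ^ 2 - 2 * c * f x) μ := h2.sub h3
          rw [integral_add h4 (integrable_const _), integral_sub h2 h3, integral_const_mul]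
          simp
  rw [e]
  nlinarith [sq_nonneg (∫ x, f x ∂μ - c)]

theorem sq_integral_le {α : Type*} [MeasurableSpace α] {μ : Measure α}
    [IsProbabilityMeasure μ] {f : α → ℝ} {B : ℝ} (hf : Measurable f) (hB : ∀ x, |f x| ≤ B) :
    (∫ x, f x ∂μ) ^ 2 ≤ ∫ x, f x ^ 2 ∂μ := by
  have h : 0 ≤ Var[f; μ] := variance_nonneg f μ
  rw [variance_eq_sub (memLp_two_iff_integrable_sq hf.aestronglyMeasurable |>.2
    (integrable_sq_of_abs_le hf hB))] at h
  simpa using h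

variable {E : Type*} [MeasurableSpace E] (μ : Measure E) [IsProbabilityMeasure μ]

/-- Here the first coordinate is integrated innermost, unlike in `lintegral_pi_succ`: the induction
below averages it out. -/
theorem integral_pi_succ {n : ℕ} {F : (Fin (n + 1) → E) → ℝ} {B : ℝ} (hF : Measurable F)
    (hB : ∀ x, |F x| ≤ B) :
    ∫ x, F x ∂Measure.pi (fun _ => μ) =
      ∫ y, ∫ a, F (Fin.cons a y) ∂μ ∂Measure.pi (fun _ => μ) := by
  have h := measurePreserving_consEquiv μ n
  have hi := integrable_of_abs_le (μ := μ.prod (Measure.pi fun _ : Fin n => μ))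
    (hF.comp h.measurable) fun p => hB _
  rw [← h.map_eq, integral_map h.measurable.aemeasurable hF.aestronglyMeasurable]
  exact integral_prod_symm _ hi

/-- The Efron–Stein inequality for bounded functions: `g i` does not depend on the
coordinate `i`. -/
theorem efronStein {n : ℕ} (f : (Fin n → E) → ℝ) (g : Fin n → (Fin n → E) → ℝ) {B : ℝ}
    (hf : Measurable f) (hfB : ∀ x, |f x| ≤ B) (hg : ∀ i, Measurable (g i))
    (hgB : ∀ i x, |g i x| ≤ B) (hgi : ∀ i x a, g i (Function.update x i a) = g i x) :
    ∫ x, f x ^ 2 ∂Measure.pi (fun _ => μ) - (∫ x, f x ∂Measure.pi (fun _ => μ)) ^ 2 ≤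
      ∑ i, ∫ x, (f x - g i x) ^ 2 ∂Measure.pi (fun _ => μ) := by
  induction n with
  | zero =>
    have e : ∀ x : Fin 0 → E, f x = f finZeroElim := fun x => congrArg f (Subsingleton.elim _ _)
    simp [e]
  | succ n ih =>
    have hcons := (measurePreserving_consEquiv μ n).measurable
    have hconsy : ∀ y : Fin n → E, Measurable fun a => (Fin.cons a y : Fin (n + 1) → E) :=
      fun y => hcons.comp measurable_prodMk_right
    have hint : ∀ u : (Fin (n + 1) → E) → ℝ, Measurable u →
        Measurable fun y : Fin n → E => ∫ a, u (Fin.cons a y) ∂μ := fun u hu =>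
      (StronglyMeasurable.integral_prod_left' (μ := μ)
        (hu.comp hcons).stronglyMeasurable).measurable
    have hsub : ∀ i x, |f x - g i x| ≤ 2 * B := fun i x => by
      linarith [abs_sub (f x) (g i x), hfB x, hgB i x]
    have hsubsq : ∀ i x, |(f x - g i x) ^ 2| ≤ (2 * B) ^ 2 := fun i x => by
      rw [abs_pow]
      exact pow_le_pow_left₀ (abs_nonneg _) (hsub i x) 2
    have hfsq : ∀ x, |f x ^ 2| ≤ B ^ 2 := fun x => by
      rw [abs_pow]
      exact pow_le_pow_left₀ (abs_nonneg _) (hfB x) 2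
    -- Law of total variance over coordinate `0`: the variance of `F` is handled by induction with
    -- comparison functions `G i`, the mean conditional variance by `g 0`.
    set F : (Fin n → E) → ℝ := fun y => ∫ a, f (Fin.cons a y) ∂μ with hFdef
    set G : Fin n → (Fin n → E) → ℝ := fun i y => ∫ a, g i.succ (Fin.cons a y) ∂μ with hGdef
    have hF : Measurable F := hint f hf
    have hG : ∀ i, Measurable (G i) := fun i => hint _ (hg i.succ)
    have hFB : ∀ y, |F y| ≤ B := fun y => abs_integral_le_of_abs_le fun a => hfB _
    have hGB : ∀ i y, |G i y| ≤ B := fun i y => abs_integral_le_of_abs_le fun a => hgB _ _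
    have hI := ih F G hF hFB hG hGB fun i y b => by
      have e : ∀ a : E, g i.succ (Fin.cons a (Function.update y i b)) =
          g i.succ (Fin.cons a y) := fun a =>
        (congrArg (g i.succ) (Fin.cons_update (α := fun _ => E) a y i b)).trans (hgi i.succ _ b)
      simp only [hGdef, e]
    -- Jensen's inequality: averaging over coordinate `0` only decreases the mean square.
    have hrest : ∀ i : Fin n, ∫ y, (F y - G i y) ^ 2 ∂Measure.pi (fun _ => μ) ≤
        ∫ x, (f x - g i.succ x) ^ 2 ∂Measure.pi (fun _ => μ) := by
      intro i
      have hm : Measurable fun x => (f x - g i.succ x) ^ 2 := (hf.sub (hg i.succ)).pow_const 2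
      rw [integral_pi_succ μ hm (hsubsq i.succ)]
      refine integral_mono ?_ ?_ fun y => ?_
      · exact integrable_sq_of_abs_le (B := 2 * B) (hF.sub (hG i)) fun y => by
          linarith [abs_sub (F y) (G i y), hFB y, hGB i y]
      · exact integrable_of_abs_le (hint _ hm) fun y =>
          abs_integral_le_of_abs_le fun a => hsubsq i.succ _
      · have e : F y - G i y = ∫ a, (f (Fin.cons a y) - g i.succ (Fin.cons a y)) ∂μ :=
          (integral_sub (integrable_of_abs_le (hf.comp (hconsy y)) fun a => hfB _)
            (integrable_of_abs_le ((hg i.succ).comp (hconsy y)) fun a => hgB _ _)).symm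
        simp only [e]
        exact sq_integral_le ((hf.sub (hg i.succ)).comp (hconsy y)) fun a => hsub i.succ _
    have hfirst : ∫ x, f x ^ 2 ∂Measure.pi (fun _ => μ) - ∫ y, F y ^ 2 ∂Measure.pi (fun _ => μ) ≤
        ∫ x, (f x - g 0 x) ^ 2 ∂Measure.pi (fun _ => μ) := by
      have hm : Measurable fun x => (f x - g 0 x) ^ 2 := (hf.sub (hg 0)).pow_const 2
      have hi1 : Integrable (fun y => ∫ a, f (Fin.cons a y) ^ 2 ∂μ)
          (Measure.pi fun _ : Fin n => μ) :=
        integrable_of_abs_le (hint _ (hf.pow_const 2)) fun y =>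
          abs_integral_le_of_abs_le fun a => hfsq _
      have hi2 : Integrable (fun y => F y ^ 2) (Measure.pi fun _ : Fin n => μ) :=
        integrable_sq_of_abs_le hF hFB
      rw [integral_pi_succ μ hm (hsubsq 0), integral_pi_succ μ (hf.pow_const 2) hfsq,
        ← integral_sub hi1 hi2]
      refine integral_mono (hi1.sub hi2) ?_ fun y => ?_
      · exact integrable_of_abs_le (hint _ hm) fun y =>
          abs_integral_le_of_abs_le fun a => hsubsq 0 _
      -- For fixed `y`, `g 0` is constant in the first coordinate, hence an admissible centre.
      · obtain ⟨b⟩ : Nonempty E := nonempty_of_isProbabilityMeasure μ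
        have e : ∀ a, g 0 (Fin.cons a y) = g 0 (Fin.cons b y) := fun a => by
          rw [← hgi 0 (Fin.cons b y) a, Fin.update_cons_zero]
        simp only [e]
        exact integral_sq_sub_sq_integral_le (hf.comp (hconsy y)) (fun a => hfB _) _
    have hmean : ∫ x, f x ∂Measure.pi (fun _ => μ) = ∫ y, F y ∂Measure.pi (fun _ => μ) :=
      integral_pi_succ μ hf hfB
    rw [Fin.sum_univ_succ, hmean]
    have := Finset.sum_le_sum fun i (_ : i ∈ Finset.univ) => hrest i
    linarith

end EfronStein

/-! ### Variance of the shortest tour. -/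

namespace CityConfig

variable (C : CityConfig)

section Nodes

variable {μ : Measure Plane} [IsProbabilityMeasure μ]

theorem ae_forall_mem_region (hμ : μ C.regionᶜ = 0) (n : ℕ) :
    ∀ᵐ x ∂Measure.pi (fun _ : Fin n => μ), ∀ i, x i ∈ C.region := by
  rw [ae_all_iff]
  intro i
  have h : ∀ᵐ y ∂μ, y ∈ C.region := hμ
  exact (measurePreserving_eval (fun _ : Fin n => μ) i).quasiMeasurePreserving.ae h

/-- The event that some city contains none of the nodes other than the `i`-th one. -/
def emptyCity {n : ℕ} (i : Fin (n + 1)) : Set (Fin (n + 1) → Plane) :=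
  {x | ∃ z ∈ C.cities, ∀ j, x (i.succAbove j) ∉ C.square z}

theorem emptyCity_eq {n : ℕ} (i : Fin (n + 1)) :
    C.emptyCity i = ⋃ z ∈ C.cities, Set.univ.pi
      (i.insertNth Set.univ fun _ => (C.square z)ᶜ : Fin (n + 1) → Set Plane) := by
  ext x
  simp [emptyCity, Fin.forall_iff_succAbove i]

theorem measurableSet_emptyCity {n : ℕ} (i : Fin (n + 1)) : MeasurableSet (C.emptyCity i) := by
  rw [emptyCity_eq]
  refine C.cities.measurableSet_biUnion fun z _ => MeasurableSet.univ_pi fun k => ?_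
  induction k using Fin.succAboveCases i with
  | x => simp
  | p j => simpa using (C.measurableSet_square z)

/-- A given city is missed by the `n` other independent nodes with probability at most `(1 - p)ⁿ ≤
e^{-np}`; then a union bound over cities. -/
theorem measureReal_emptyCity_le {p : ℝ} (hp : ∀ z ∈ C.cities, p ≤ μ.real (C.square z)) {n : ℕ}
    (i : Fin (n + 1)) :
    (Measure.pi fun _ => μ).real (C.emptyCity i) ≤ C.N * Real.exp (-(n * p)) := by
  rw [emptyCity_eq]
  refine (measureReal_biUnion_finset_le _ _).trans ?_
  rw [N, ← nsmul_eq_mul]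
  refine Finset.sum_le_card_nsmul _ _ _ fun z hz => ?_
  rw [Measure.real, Measure.pi_pi, Fin.prod_univ_succAbove _ i]
  simp only [Fin.insertNth_apply_same, Fin.insertNth_apply_succAbove, measure_univ, one_mul,
    Finset.prod_const, Finset.card_univ, Fintype.card_fin, ENNReal.toReal_pow]
  have h1 : (μ (C.square z)ᶜ).toReal = 1 - μ.real (C.square z) :=
    probReal_compl_eq_one_sub (C.measurableSet_square z)
  have h2 : (μ (C.square z)ᶜ).toReal ≤ Real.exp (-p) := by
    rw [h1]
    linarith [hp z hz, Real.add_one_le_exp (-p)]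
  refine (pow_le_pow_left₀ ENNReal.toReal_nonneg h2 n).trans_eq ?_
  rw [← Real.exp_nat_mul]
  congr 1
  ring

theorem tspLength_sub_succAbove_le {n : ℕ} {x : Fin (n + 2) → Plane}
    (hx : ∀ i, x i ∈ C.region) (i : Fin (n + 2)) :
    tspLength x - tspLength (fun j => x (i.succAbove j)) ≤ 4 := by
  have h := tspLength_le_succAbove_add x (Fin.succAbove_ne i 0)
  have := dist_le_of_mem_unitSquare (C.region_subset_unitSquare (hx i))
    (C.region_subset_unitSquare (hx (i.succAbove 0)))
  linarith

theorem tspLength_sub_succAbove_le_of_notMem {n : ℕ} {x : Fin (n + 1) → Plane}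
    (hx : ∀ i, x i ∈ C.region) {i : Fin (n + 1)} (hi : x ∉ C.emptyCity i) :
    tspLength x - tspLength (fun j => x (i.succAbove j)) ≤ 4 * C.r := by
  obtain ⟨z, hz, hxz⟩ := C.mem_region.1 (hx i)
  simp only [emptyCity, Set.mem_ofPred_eq, not_exists, not_and, not_forall, not_not] at hi
  obtain ⟨j, hj⟩ := hi z hz
  have h := tspLength_le_succAbove_add x (Fin.succAbove_ne i j)
  have := C.dist_le_of_mem_square hxz hj
  linarith

theorem ae_tspLength_le (hμ : μ C.regionᶜ = 0) (n : ℕ) :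
    ∀ᵐ x ∂Measure.pi (fun _ : Fin n => μ),
      tspLength x ≤ 4 * C.N * (C.r + C.s) + 24 * C.scale n := by
  filter_upwards [C.ae_forall_mem_region hμ n] with x hx using C.tspLength_le x hx

theorem memLp_tspLength (hμ : μ C.regionᶜ = 0) (n : ℕ) (p : ENNReal) :
    MemLp (fun x => tspLength x) p (Measure.pi fun _ : Fin n => μ) := by
  refine .of_bound (measurable_tspLength n).aestronglyMeasurable
    (4 * C.N * (C.r + C.s) + 24 * C.scale n) ?_
  filter_upwards [C.ae_tspLength_le hμ n] with x hx
  rwa [Real.norm_of_nonneg (tspLength_nonneg x)]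

theorem variance_tspLength_le (hμ : μ C.regionᶜ = 0) {p : ℝ}
    (hp : ∀ z ∈ C.cities, p ≤ μ.real (C.square z)) (n : ℕ) :
    Var[fun x => tspLength x; Measure.pi fun _ : Fin (n + 2) => μ] ≤
      (n + 2) * (16 * (C.r ^ 2 + C.N * Real.exp (-((n + 1) * p)))) := by
  set ν := Measure.pi fun _ : Fin (n + 2) => μ
  set B := 4 * C.N * (C.r + C.s) + 24 * C.scale (n + 2)
  have hB : 0 ≤ B := by
    have := C.step_pos.le
    have := C.r_pos.le
    simp only [B, scale]
    positivity
  -- `efronStein` needs bounds everywhere; truncating at the almost sure bound `B` changes nothing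
  -- almost everywhere.
  set f : (Fin (n + 2) → Plane) → ℝ := fun x => min (tspLength x) B
  set g : Fin (n + 2) → (Fin (n + 2) → Plane) → ℝ :=
    fun i x => min (tspLength fun j => x (i.succAbove j)) B
  have hf : Measurable f := (measurable_tspLength _).min measurable_const
  have hg : ∀ i, Measurable (g i) := fun i =>
    ((measurable_tspLength _).comp (g := fun y : Fin (n + 1) → Plane => tspLength y)
      (f := fun x : Fin (n + 2) → Plane => fun j => x (i.succAbove j))
      (measurable_pi_lambda _ fun j => measurable_pi_apply _)).min measurable_const
  have habs : ∀ t : ℝ, 0 ≤ t → |min t B| ≤ B := fun t ht => by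
    rw [abs_of_nonneg (le_min ht hB)]
    exact min_le_right _ _
  have hES := efronStein μ f g hf (fun x => habs _ (tspLength_nonneg _)) hg
    (fun i x => habs _ (tspLength_nonneg _)) fun i x a => by
      simp [g]
  have hfT : (fun x => tspLength x) =ᵐ[ν] f := by
    filter_upwards [C.ae_tspLength_le hμ (n + 2)] with x hx
    exact (min_eq_left hx).symm
  rw [variance_congr hfT, variance_eq_sub ((memLp_congr_ae hfT).1 (C.memLp_tspLength hμ _ 2))]
  refine hES.trans ?_
  have hterm : ∀ i, ∫ x, (f x - g i x) ^ 2 ∂ν ≤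
      16 * (C.r ^ 2 + C.N * Real.exp (-((n + 1) * p))) := by
    intro i
    have hms := C.measurableSet_emptyCity i
    have hind : Integrable ((C.emptyCity i).indicator fun _ => (16 : ℝ)) ν :=
      (integrable_const _).indicator hms
    calc ∫ x, (f x - g i x) ^ 2 ∂ν
        ≤ ∫ x, (16 * C.r ^ 2 + (C.emptyCity i).indicator (fun _ => 16) x) ∂ν := by
          refine integral_mono_of_nonneg (ae_of_all _ fun x => sq_nonneg _)
            ((integrable_const _).add hind) ?_
          filter_upwards [C.ae_forall_mem_region hμ (n + 2)] with x hx
          have h0 := tspLength_succAbove_le x i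
          have h1 : |f x - g i x| ≤ tspLength x - tspLength fun j => x (i.succAbove j) := by
            refine (abs_min_sub_min_le_max _ _ _ _).trans ?_
            rw [sub_self, abs_zero, abs_of_nonneg (sub_nonneg.2 h0)]
            exact max_le le_rfl (sub_nonneg.2 h0)
          have hr := C.r_pos
          rw [← sq_abs]
          by_cases hxi : x ∈ C.emptyCity i
          · rw [Set.indicator_of_mem hxi]
            have h2 := h1.trans (C.tspLength_sub_succAbove_le hx i)
            nlinarith [abs_nonneg (f x - g i x), sq_nonneg C.r]
          · rw [Set.indicator_of_notMem hxi]
            have h2 := h1.trans (C.tspLength_sub_succAbove_le_of_notMem hx hxi)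
            nlinarith [abs_nonneg (f x - g i x)]
      _ = 16 * C.r ^ 2 + 16 * ν.real (C.emptyCity i) := by
          rw [integral_add (integrable_const _) hind, integral_indicator_const _ hms]
          simp [mul_comm]
      _ ≤ _ := by
          have := C.measureReal_emptyCity_le hp i
          push_cast at this
          linarith
  refine (Finset.sum_le_card_nsmul _ _ _ fun i _ => hterm i).trans_eq ?_
  simp

end Nodes

end CityConfig

/-! ### Estimates at the scale `b`. -/

namespace CityConfig

variable (C : CityConfig)

theorem scale_pos {n : ℕ} (hn : 0 < n) : 0 < C.scale n := by
  have := C.r_pos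
  have := C.one_le_N
  have : (0 : ℝ) < n := by exact_mod_cast hn
  unfold scale
  positivity

theorem scale_sq (n : ℕ) : C.scale n ^ 2 = C.r ^ 2 * (n * C.N) := by
  rw [scale, mul_pow, Real.sq_sqrt (by positivity)]

theorem factorial_mul_exp_le {m : ℕ} (hm : 5 ≤ m) :
    ((m + 1).factorial : ℝ) * (Real.exp (m + 1) * (Real.exp (-3) / (m + 1)) ^ m) ≤
      Real.exp (-(m + 1)) := by
  have hm' : (5 : ℝ) ≤ m := by exact_mod_cast hm
  have h1 : ((m + 1).factorial : ℝ) ≤ (m + 1 : ℝ) ^ (m + 1) := by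
    exact_mod_cast Nat.factorial_le_pow (m + 1)
  -- From `e^{(m-2)/2} ≥ m/2`; the inequality `m²/4 ≥ m + 1` needs `5 ≤ m`.
  have h2 : (m + 1 : ℝ) ≤ Real.exp (m - 2) := by
    have h3 := Real.add_one_le_exp (((m : ℝ) - 2) / 2)
    have h4 : Real.exp (m - 2) = Real.exp (((m : ℝ) - 2) / 2) ^ 2 := by
      rw [← Real.exp_nat_mul]
      congr 1
      push_cast
      ring
    rw [h4]
    nlinarith
  have hpos : (0 : ℝ) < m + 1 := by linarith
  calc _ ≤ (m + 1 : ℝ) ^ (m + 1) * (Real.exp (m + 1) * (Real.exp (-3) / (m + 1)) ^ m) := by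
        gcongr
    _ = (m + 1) * (Real.exp (m + 1) * Real.exp (-3) ^ m) := by
        rw [div_pow, pow_succ]
        field_simp
    _ = (m + 1) * Real.exp (m + 1 - 3 * m) := by
        rw [← Real.exp_nat_mul, ← Real.exp_add]
        ring_nf
    _ ≤ Real.exp (m - 2) * Real.exp (m + 1 - 3 * m) := by gcongr
    _ = Real.exp (-(m + 1)) := by
        rw [← Real.exp_add]
        ring_nf

theorem measure_tspLength_lt_scale_le {μ : Measure Plane} [IsProbabilityMeasure μ] {κ θ : ℝ}
    (hκ : 0 < κ) (hθ : 0 < θ) (hθκ : 16 * κ * θ ^ 2 = Real.exp (-3))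
    (hμ : μ ≤ ENNReal.ofReal (κ / (C.N * C.r ^ 2)) • volume) {n : ℕ} (hn : 6 ≤ n) :
    Measure.pi (fun _ : Fin n => μ) {x | tspLength x < θ * C.scale n} ≤
      ENNReal.ofReal (Real.exp (-n)) := by
  obtain ⟨m, rfl⟩ : ∃ m, n = m + 1 := ⟨n - 1, by omega⟩
  have hb := C.scale_pos (Nat.succ_pos m)
  have hb2 := C.scale_sq (m + 1)
  have hA := C.area_pos
  have hr := C.r_pos
  have hN := C.one_le_N
  have hpos : (0 : ℝ) < m + 1 := by positivity
  push_cast at hb2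
  set b := C.scale (m + 1)
  have hD : 0 ≤ κ / (C.N * C.r ^ 2) := by positivity
  -- With `n = m + 1`, the choice `c = n / (θ b)` makes the exponent `c L` equal to `n` and the
  -- one-step factor equal to `e⁻³ / n`.
  refine (measure_tspLength_lt_le μ hD hμ (c := (m + 1) / (θ * b)) (by positivity) (θ * b)
    m).trans (ENNReal.ofReal_le_ofReal ?_)
  have e1 : (m + 1) / (θ * b) * (θ * b) = m + 1 := div_mul_cancel₀ _ (by positivity)
  have e2 : κ / (C.N * C.r ^ 2) * (16 / ((m + 1) / (θ * b)) ^ 2) = Real.exp (-3) / (m + 1) := by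
    rw [div_pow, mul_pow, hb2, ← hθκ]
    field_simp
  rw [e1, e2]
  push_cast
  exact factorial_mul_exp_le (by omega)

/-- The cities have total area `N r² ≤ 1`, so a lower bound on `r²` limits their number. -/
theorem natCast_N_le {M : ℝ} (hM : 1 ≤ M) {n : ℕ} (hn : 3 ≤ n)
    (h : M * Real.log n / n ≤ C.r ^ 2) :
    1 ≤ Real.log n ∧ 1 ≤ n * C.r ^ 2 ∧ M * Real.log n * C.N ≤ n ∧ (C.N : ℝ) ≤ n := by
  have hn' : (3 : ℝ) ≤ n := by exact_mod_cast hn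
  have hlog : 1 ≤ Real.log n := by
    rw [Real.le_log_iff_exp_le (by linarith)]
    linarith [Real.exp_one_lt_d9]
  have hN := C.one_le_N
  have ha := C.area_le_one
  rw [div_le_iff₀ (by linarith)] at h
  have h1 : 1 ≤ M * Real.log n := one_le_mul_of_one_le_of_one_le hM hlog
  have h2 : M * Real.log n * C.N ≤ n :=
    calc M * Real.log n * C.N ≤ C.r ^ 2 * n * C.N := by gcongr
      _ = (C.N * C.r ^ 2) * n := by ring
      _ ≤ n := mul_le_of_le_one_left (by linarith) ha
  refine ⟨hlog, by linarith, h2, le_trans ?_ h2⟩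
  exact le_mul_of_one_le_left (by linarith) h1

/-- The variance of the length of the shortest tour is of order at most `n r²`. -/
theorem variance_tspLength_le_mul {μ : Measure Plane} [IsProbabilityMeasure μ]
    (hμ : μ C.regionᶜ = 0) {κ M : ℝ} (hκ : 1 ≤ κ) (hM : 4 * κ ≤ M)
    (hp : ∀ z ∈ C.cities, κ⁻¹ / C.N ≤ μ.real (C.square z)) {n : ℕ} (hn : 3 ≤ n)
    (h : M * Real.log n / n ≤ C.r ^ 2) :
    Var[fun x => tspLength x; Measure.pi fun _ : Fin n => μ] ≤ 32 * (n * C.r ^ 2) := by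
  obtain ⟨hlog, hnr, hMN, hNn⟩ := C.natCast_N_le (by linarith) hn h
  obtain ⟨m, rfl⟩ : ∃ m, n = m + 2 := ⟨n - 2, by omega⟩
  refine (C.variance_tspLength_le hμ hp m).trans ?_
  have hN := C.one_le_N
  have hm1 : (1 : ℝ) ≤ m := by exact_mod_cast (by omega : 1 ≤ m)
  push_cast at *
  have hpos : (0 : ℝ) < m + 2 := by linarith
  have hexp : C.N * Real.exp (-((m + 1) * (κ⁻¹ / C.N))) ≤ C.r ^ 2 := by
    -- With `n = m + 2`: `4κ N log n ≤ n` and `n ≤ 2(n - 1)`. The empty-city probability is then at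
    -- most `n · n⁻² ≤ r²`.
    have h1 : 2 * Real.log (m + 2) ≤ (m + 1) * (κ⁻¹ / C.N) := by
      have h2 : 4 * κ * Real.log (m + 2) * C.N ≤ M * Real.log (m + 2) * C.N := by gcongr
      have h3 : (m + 1) * (κ⁻¹ / C.N) = (m + 1) / (κ * C.N) := by field_simp
      rw [h3, le_div_iff₀ (by positivity)]
      nlinarith
    have h4 : Real.exp (-(2 * Real.log (m + 2))) = 1 / (m + 2 : ℝ) ^ 2 := by
      rw [Real.exp_neg, two_mul, Real.exp_add, Real.exp_log hpos, one_div, sq]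
    calc C.N * Real.exp (-((m + 1) * (κ⁻¹ / C.N)))
        ≤ (m + 2) * Real.exp (-(2 * Real.log (m + 2))) := by gcongr
      _ = 1 / (m + 2) := by rw [h4]; field_simp
      _ ≤ C.r ^ 2 := by rw [div_le_iff₀ hpos]; linarith
  nlinarith

/-- `32 = 4 + 4 + 24`, from `N r ≤ b`, `N s ≤ b` and the insertion cost. -/
theorem tspLength_bound_le_scale {n : ℕ} (hn : 0 < n) (hNn : (C.N : ℝ) ≤ n)
    (hs : C.N * C.s / C.scale n ≤ 1) :
    4 * C.N * (C.r + C.s) + 24 * C.scale n ≤ 32 * C.scale n := by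
  rw [div_le_one (C.scale_pos hn)] at hs
  have h1 : C.N * C.r ≤ C.scale n := by
    rw [scale, mul_comm]
    refine mul_le_mul_of_nonneg_left (Real.le_sqrt_of_sq_le ?_) C.r_pos.le
    rw [sq]
    gcongr
  linarith

end CityConfig

/-! ### Assembly of the theorem. -/

theorem tendsto_one_div_of_tendsto_div_sq {a : ℕ → ℝ} (ha : ∀ n, 1 ≤ a n)
    (h : Tendsto (fun n : ℕ => (n : ℝ) / a n ^ 2) atTop (𝓝 0)) :
    Tendsto (fun n => 1 / a n) atTop (𝓝 0) := by
  have h1 : Tendsto (fun n : ℕ => √((n : ℝ) / a n ^ 2)) atTop (𝓝 0) := by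
    simpa using h.sqrt
  refine squeeze_zero' (Eventually.of_forall fun n => ?_) ?_ h1
  · have := ha n
    positivity
  · filter_upwards [eventually_ge_atTop 1] with n hn
    have hn' : (1 : ℝ) ≤ n := by exact_mod_cast hn
    have := ha n
    refine Real.le_sqrt_of_sq_le ?_
    rw [div_pow, one_pow]
    gcongr

theorem theorem1 (ε₁ ε₂ : ℝ) (hε₁ : 0 < ε₁) (hε : ε₁ ≤ ε₂) :
    ∃ M₀ θ₁ θ₂ θ₃ θ₄ θ₅ θ₆ : ℝ,
      0 < M₀ ∧ 0 < θ₁ ∧ 0 < θ₂ ∧ 0 < θ₃ ∧ 0 < θ₄ ∧ 0 < θ₅ ∧ 0 < θ₆ ∧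
      ∀ (M : ℝ), M₀ ≤ M →
      ∀ (f : Plane → ℝ), Measurable f →
        (∀ x ∈ unitSquare, ε₁ ≤ f x ∧ f x ≤ ε₂) →
        (∫ x in unitSquare, f x) = 1 →
      ∀ (C : ℕ → CityConfig),
        (∀ᶠ n : ℕ in atTop, M * Real.log n / n ≤ (C n).r ^ 2) →
        Tendsto (fun n : ℕ => (n : ℝ) / ((C n).N : ℝ) ^ 2) atTop (𝓝 0) →
        Tendsto (fun n : ℕ => ((C n).N : ℝ) * (C n).s / (C n).scale n) atTop (𝓝 0) →
      ∀ (Ω : Type*) [MeasurableSpace Ω] (P : Measure Ω) [IsProbabilityMeasure P]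
        (X : (n : ℕ) → Fin n → Ω → Plane),
        (∀ n i, Measurable (X n i)) →
        (∀ n, iIndepFun (X n) P) →
        (∀ n i, P.map (X n i) =
          volume.withDensity fun x => ENNReal.ofReal ((C n).density f x)) →
      (∀ n, Integrable (fun ω => tspLength fun i => X n i ω) P) ∧
      TendstoInMeasure P
        (fun (n : ℕ) (ω : Ω) =>
          ((tspLength fun i => X n i ω) - ∫ ω', (tspLength fun i => X n i ω') ∂P) /
            (C n).scale n)
        atTop (fun _ => (0 : ℝ)) ∧
      ∀ᶠ n : ℕ in atTop,
        (θ₁ * (C n).scale n ≤ ∫ ω, (tspLength fun i => X n i ω) ∂P) ∧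
        ((∫ ω, (tspLength fun i => X n i ω) ∂P) ≤ θ₂ * (C n).scale n) ∧
        1 - Real.exp (-θ₄ * (C n).N) ≤
          P.real {ω | θ₃ * (C n).scale n ≤ tspLength fun i => X n i ω} ∧
        1 - Real.exp (-θ₆ * ((n : ℝ) / (C n).N)) ≤
          P.real {ω | (tspLength fun i => X n i ω) ≤ θ₅ * (C n).scale n} := by
  have hε₂ : 0 < ε₂ := hε₁.trans_le hε
  set κ := ε₂ / ε₁ with hκdef
  have hκ : 1 ≤ κ := (one_le_div hε₁).2 hε
  have hκ0 : 0 < κ := by linarith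
  -- Normalised so that `16 κ θ² = e⁻³`, the one-step factor that beats `n! eⁿ`.
  set θ := √(Real.exp (-3) / (16 * κ)) with hθdef
  have hθ : 0 < θ := Real.sqrt_pos.2 (div_pos (Real.exp_pos _) (by positivity))
  have hθκ : 16 * κ * θ ^ 2 = Real.exp (-3) := by
    rw [hθdef, Real.sq_sqrt (div_pos (Real.exp_pos _) (by positivity)).le]
    field_simp
  refine ⟨4 * κ, θ / 2, 32, θ, 1, 32, 1, by positivity, by positivity, by norm_num, hθ,
    one_pos, by norm_num, one_pos, ?_⟩
  intro M hM f _ hf hfint C hr hN hs Ω _ P _ X hX hind hlaw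
  have hint : IntegrableOn f unitSquare := by
    by_contra hn
    rw [integral_undef hn] at hfint
    exact zero_ne_one hfint
  have hprob : ∀ n, 0 < n → IsProbabilityMeasure ((C n).law f) := fun n hn => by
    rw [CityConfig.law, ← hlaw n ⟨0, hn⟩]
    exact Measure.isProbabilityMeasure_map (hX n _).aemeasurable
  have hXm : ∀ n, Measurable fun ω i => X n i ω := fun n => measurable_pi_lambda _ (hX n)
  have hmp : ∀ n, MeasurePreserving (fun ω i => X n i ω) P
      (Measure.pi fun _ : Fin n => (C n).law f) := fun n => by
    refine ⟨hXm n, ?_⟩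
    rw [(iIndepFun_iff_map_fun_eq_pi_map fun i => (hX n i).aemeasurable).1 (hind n)]
    congr 1
    ext1 i
    exact hlaw n i
  have hTm : ∀ n, Measurable fun ω => tspLength fun i => X n i ω := fun n =>
    (measurable_tspLength n).comp (hXm n)
  have hmem : ∀ n, 0 < n → MemLp (fun ω => tspLength fun i => X n i ω) 2 P := fun n hn => by
    have := hprob n hn
    exact ((C n).memLp_tspLength (C n).law_compl_region n 2).comp_measurePreserving (hmp n)
  have hintegrable : ∀ n, Integrable (fun ω => tspLength fun i => X n i ω) P := fun n => by
    rcases Nat.eq_zero_or_pos n with rfl | hn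
    -- For `n = 0` there is no node to show that `law` is a probability measure, but `T` is
    -- constant.
    · have e : ∀ ω, (tspLength fun i => X 0 i ω) = tspLength finZeroElim := fun ω =>
        congrArg tspLength (Subsingleton.elim _ _)
      simp only [e]
      exact integrable_const _
    · exact (hmem n hn).integrable one_le_two
  refine ⟨hintegrable, ?_, ?_⟩
  · rw [tendstoInMeasure_iff_norm]
    intro δ hδ
    have hlim : Tendsto (fun n => ENNReal.ofReal (32 / δ ^ 2 * (1 / (C n).N : ℝ))) atTop
        (𝓝 0) := by
      have h1 := (tendsto_one_div_of_tendsto_div_sq (fun n => (C n).one_le_N) hN).const_mul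
        (32 / δ ^ 2)
      rw [mul_zero] at h1
      simpa using ENNReal.tendsto_ofReal h1
    refine tendsto_of_tendsto_of_tendsto_of_le_of_le' tendsto_const_nhds hlim
      (Eventually.of_forall fun _ => zero_le) ?_
    filter_upwards [hr, eventually_ge_atTop 3] with n hrn hn
    have hn0 : 0 < n := by omega
    have := hprob n hn0
    have hb := (C n).scale_pos hn0
    have hb2 := (C n).scale_sq n
    have hN1 := (C n).one_le_N
    have hrp := (C n).r_pos
    have hnp : (0 : ℝ) < n := by exact_mod_cast hn0
    have hvar : Var[fun ω => tspLength fun i => X n i ω; P] ≤ 32 * (n * (C n).r ^ 2) := by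
      have h1 := (hmp n).variance_fun_comp (measurable_tspLength n).aemeasurable
      rw [h1]
      refine (C n).variance_tspLength_le_mul (C n).law_compl_region hκ hM (fun z hz => ?_) hn hrn
      have h2 := (C n).le_law_square hε₁ hf hint hz
      rw [ENNReal.ofReal_le_iff_le_toReal (measure_ne_top _ _)] at h2
      rwa [hκdef, inv_div]
    have hcheb := meas_ge_le_variance_div_sq (hmem n hn0) (c := δ * (C n).scale n)
      (by positivity)
    refine (measure_mono fun ω hω => ?_).trans (hcheb.trans (ENNReal.ofReal_le_ofReal ?_))
    · have hω' : δ ≤ ‖((tspLength fun i => X n i ω) -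
          ∫ ω', (tspLength fun i => X n i ω') ∂P) / (C n).scale n - 0‖ := hω
      rw [sub_zero, norm_div, Real.norm_of_nonneg hb.le, le_div_iff₀ hb, Real.norm_eq_abs] at hω'
      exact hω'
    -- Since `b² = r² n N`, Chebyshev's bound is `32 / (δ² N)`.
    · calc _ ≤ 32 * (n * (C n).r ^ 2) / (δ * (C n).scale n) ^ 2 := by gcongr
        _ = _ := by rw [mul_pow, hb2]; field_simp
  · filter_upwards [hr, eventually_ge_atTop 6, hs.eventually_le_const one_pos]
      with n hrn hn hsn
    have hn0 : 0 < n := by omega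
    have := hprob n hn0
    have hb := (C n).scale_pos hn0
    obtain ⟨-, -, -, hNn⟩ := (C n).natCast_N_le (by linarith) (by omega) hrn
    have hN1 := (C n).one_le_N
    have hup : ∀ᵐ ω ∂P, (tspLength fun i => X n i ω) ≤ 32 * (C n).scale n := by
      have h1 := (hmp n).quasiMeasurePreserving.ae
        ((C n).ae_tspLength_le (C n).law_compl_region n)
      filter_upwards [h1] with ω hω
      exact hω.trans ((C n).tspLength_bound_le_scale hn0 hNn hsn)
    have hlow : 1 - Real.exp (-1 * (C n).N) ≤
        P.real {ω | θ * (C n).scale n ≤ tspLength fun i => X n i ω} := by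
      have h1 := (C n).measure_tspLength_lt_scale_le hκ0 hθ hθκ
        ((C n).law_le hε₁ hf hint) hn
      rw [← (hmp n).measure_preimage (measurableSet_lt (measurable_tspLength n)
        measurable_const).nullMeasurableSet] at h1
      have h2 : P.real {ω | θ * (C n).scale n ≤ tspLength fun i => X n i ω}ᶜ ≤
          Real.exp (-n) := by
        refine ENNReal.toReal_le_of_le_ofReal (Real.exp_pos _).le (le_trans ?_ h1)
        refine measure_mono fun ω hω => ?_
        have hω' : ¬ θ * (C n).scale n ≤ tspLength fun i => X n i ω := hω
        exact not_le.1 hω'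
      rw [probReal_compl_eq_one_sub (measurableSet_le measurable_const (hTm n))] at h2
      have h3 : Real.exp (-(n : ℝ)) ≤ Real.exp (-1 * (C n).N) :=
        Real.exp_le_exp.2 (by linarith)
      linarith
    refine ⟨?_, ?_, hlow, ?_⟩
    -- Markov: `E T ≥ θ b · P(T ≥ θ b)`, where the probability is at least `1 - e⁻¹ ≥ 1/2` because
    -- `N ≥ 1`.
    · have h1 := mul_meas_ge_le_integral_of_nonneg
        (ae_of_all P fun ω => tspLength_nonneg fun i => X n i ω) (hintegrable n)
        (θ * (C n).scale n)
      have h2 : (1 : ℝ) / 2 ≤ P.real {ω | θ * (C n).scale n ≤ tspLength fun i => X n i ω} := by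
        refine le_trans ?_ hlow
        have h3 : Real.exp (-1 * (C n).N) ≤ Real.exp (-1) := Real.exp_le_exp.2 (by linarith)
        linarith [Real.exp_neg_one_lt_half]
      have h4 := mul_le_mul_of_nonneg_left h2 (mul_pos hθ hb).le
      linarith
    · have h1 := integral_mono_ae (hintegrable n) (integrable_const _) hup
      simpa using h1
    -- The upper bound holds almost surely, so any positive `θ₆` would do.
    · have h1 : P.real {ω | (tspLength fun i => X n i ω) ≤ 32 * (C n).scale n} = 1 := by
        rw [Measure.real, measure_congr (eventuallyEq_univ.2 hup), measure_univ, ENNReal.toReal_one]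
      rw [h1]
      linarith [Real.exp_pos (-1 * ((n : ℝ) / (C n).N))]
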